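/- Let $d_A\ge 2$ and let $\Lambda$ be a quantum channel (a completely positive trace-preserving map) on the operators on $\mathcal H_A=\mathbb C^{d_A}$. Assume that $\Lambda$ has no correctable subspace, i.e. there is no subspace $\mathcal H_c\subseteq\mathcal H_A$ with $\dim\mathcal H_c\ge 2$ for which some quantum channel $\mathcal R$ satisfies $\mathcal R(\Lambda(|\psi\rangle\langle\psi|))=|\psi\rangle\langle\psi|$ for all $|\psi\rangle\in\mathcal H_c$. Then there is a constant $\kappa\in(0,1)$, depending only on $\Lambda$, such that for every finite-dimensional system $B$, every state $\rho^{AB}$ on $\mathcal H_A\otimes\mathcal H_B$, every $n\ge 0$ and every sequence $F_1,\dots,F_n$ of filters given by local operations and classical communication (LOCC) between $A$ and $B$ (deterministic overall, i.e. averaged over their measurement outcomes; protocols with infinitely many rounds are included as limits of finite ones, and each $F_i$ may depend on the measurement outcomes of $F_1,\dots,F_{i-1}$), the output $$\Lambda_n[\rho^{AB}]=(\Lambda\otimes\mathbb 1)\circ F_n\circ\cdots\circ(\Lambda\otimes\mathbb 1)\circ F_1[\rho^{AB}]$$ (averaged over all outcomes) satisfies $$\min_{\sigma^{AB}\in\mathcal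 S}\big\|\Lambda_n[\rho^{AB}]-\sigma^{AB}\big\|_1\le 4\,\kappa^{\frac{n}{2(d_A-1)}}\big(\sqrt{d_A}-1\big),$$ where $\mathcal S$ is the set of separable states, i.e. of finite convex combinations of product states $\alpha^A\otimes\beta^B$, $\|X\|_1=\operatorname{Tr}\sqrt{X^\dagger X}$, and the minimum is attained. -/

import Mathlib

namespace QNet

open scoped ComplexOrder MatrixOrder Kronecker

noncomputable section

/-- Operators on the Hilbert space `ℂ^d`. -/
abbrev Op (d : ℕ) : Type := Matrix (Fin d) (Fin d) ℂ

/-- Operators on the bipartite Hilbert space `ℂ^a ⊗ ℂ^b`, in the product basis. -/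
abbrev BiOp (a b : ℕ) : Type := Matrix (Fin a × Fin b) (Fin a × Fin b) ℂ

/-- The map `E ⊗ id` acting on the first tensor factor: `E` is applied to each of the blocks
`(i, j) ↦ X (i, k) (j, l)`. -/
def onA {a a' : ℕ} (b : ℕ) (E : Op a →ₗ[ℂ] Op a') : BiOp a b →ₗ[ℂ] BiOp a' b where
  toFun X := Matrix.of fun p q => E (Matrix.of fun i j => X (i, p.2) (j, q.2)) p.1 q.1
  map_add' X Y := by
    ext p q
    exact congrFun (congrFun (E.map_add (Matrix.of fun i j => X (i, p.2) (j, q.2))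
      (Matrix.of fun i j => Y (i, p.2) (j, q.2))) p.1) q.1
  map_smul' c X := by
    ext p q
    exact congrFun (congrFun (E.map_smul c (Matrix.of fun i j => X (i, p.2) (j, q.2))) p.1) q.1

/-- The map `id ⊗ E` acting on the second tensor factor. -/
def onB {b b' : ℕ} (a : ℕ) (E : Op b →ₗ[ℂ] Op b') : BiOp a b →ₗ[ℂ] BiOp a b' where
  toFun X := Matrix.of fun p q => E (Matrix.of fun k l => X (p.1, k) (q.1, l)) p.2 q.2
  map_add' X Y := by
    ext p q
    exact congrFun (congrFun (E.map_add (Matrix.of fun k l => X (p.1, k) (q.1, l))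
      (Matrix.of fun k l => Y (p.1, k) (q.1, l))) p.2) q.2
  map_smul' c X := by
    ext p q
    exact congrFun (congrFun (E.map_smul c (Matrix.of fun k l => X (p.1, k) (q.1, l))) p.2) q.2

/-- Complete positivity: `E ⊗ id` preserves positive semidefiniteness for every finite ancilla. -/
def IsCP {a a' : ℕ} (E : Op a →ₗ[ℂ] Op a') : Prop :=
  ∀ (r : ℕ) (X : BiOp a r), X.PosSemidef → (onA r E X).PosSemidef

/-- Quantum channels: completely positive trace-preserving maps. -/
def IsChannel {a a' : ℕ} (E : Op a →ₗ[ℂ] Op a') : Prop :=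
  IsCP E ∧ ∀ X : Op a, (E X).trace = X.trace

/-- Quantum instruments with outcomes `i : Fin k`: completely positive maps, possibly with different
output dimensions, whose sum preserves the trace. -/
def IsInstrument {a k : ℕ} {a₁ : Fin k → ℕ} (E : (i : Fin k) → Op a →ₗ[ℂ] Op (a₁ i)) : Prop :=
  (∀ i, IsCP (E i)) ∧ ∀ X : Op a, ∑ i, (E i X).trace = X.trace

/-- The (unnormalized) pure state `|ψ⟩⟨ψ|`. -/
def pureState {d : ℕ} (ψ : Fin d → ℂ) : Op d := Matrix.vecMulVec ψ (star ψ)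

/-- `H` is a correctable subspace of `Λ`: it has dimension at least two (every line is trivially
correctable) and some recovery channel undoes `Λ` on all its pure states. -/
def IsCorrectable {d : ℕ} (Λ : Op d →ₗ[ℂ] Op d) (H : Submodule ℂ (Fin d → ℂ)) : Prop :=
  2 ≤ Module.finrank ℂ H ∧
    ∃ R : Op d →ₗ[ℂ] Op d, IsChannel R ∧ ∀ ψ ∈ H, R (Λ (pureState ψ)) = pureState ψ

/-- Density matrices. -/
def IsState {ι : Type} [Fintype ι] (ρ : Matrix ι ι ℂ) : Prop :=
  ρ.PosSemidef ∧ ρ.trace = 1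

/-- Separable states: finite convex combinations of product states. -/
def separableStates (a b : ℕ) : Set (BiOp a b) :=
  convexHull ℝ {σ | ∃ (α : Op a) (β : Op b), IsState α ∧ IsState β ∧ σ = α ⊗ₖ β}

/-- The trace norm `‖X‖₁ = Tr √(X† X)`. -/
def traceNorm {ι : Type} [Fintype ι] [DecidableEq ι] (X : Matrix ι ι ℂ) : ℝ :=
  (CFC.sqrt (X.conjTranspose * X)).trace.re

/-- Instruments implemented by a finite protocol of local operations and classical communication
between `A` and `B`, with declared outcome `j : Fin m`. Either the parties stop and declare an
outcome, or one of them applies a local instrument (possibly changing the local dimension),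
announces the result `i`, and the parties continue with a protocol that depends on `i`.
Forgetting information amounts to not declaring it. -/
inductive IsFiniteLOCC {a' b' m : ℕ} :
    {a b : ℕ} → (Fin m → BiOp a b →ₗ[ℂ] BiOp a' b') → Prop
  | declare (j₀ : Fin m) :
      IsFiniteLOCC (fun j => if j = j₀ then (LinearMap.id : BiOp a' b' →ₗ[ℂ] BiOp a' b') else 0)
  | alice {a b k : ℕ} (a₁ : Fin k → ℕ) (E : (i : Fin k) → Op a →ₗ[ℂ] Op (a₁ i))
      (hE : IsInstrument E) (G : (i : Fin k) → Fin m → BiOp (a₁ i) b →ₗ[ℂ] BiOp a' b')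
      (hG : ∀ i, IsFiniteLOCC (G i)) :
      IsFiniteLOCC (fun j => ∑ i, (G i j) ∘ₗ (onA b (E i)))
  | bob {a b k : ℕ} (b₁ : Fin k → ℕ) (E : (i : Fin k) → Op b →ₗ[ℂ] Op (b₁ i))
      (hE : IsInstrument E) (G : (i : Fin k) → Fin m → BiOp a (b₁ i) →ₗ[ℂ] BiOp a' b')
      (hG : ∀ i, IsFiniteLOCC (G i)) :
      IsFiniteLOCC (fun j => ∑ i, (G i j) ∘ₗ (onB a (E i)))

/-- LOCC instruments on `ℂ^a ⊗ ℂ^b`: limits of instruments of finite LOCC protocols. This includes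
all finite protocols (constant sequences) and all protocols with infinitely many rounds. -/
def IsLOCC {a b m : ℕ} (F : Fin m → BiOp a b →ₗ[ℂ] BiOp a b) : Prop :=
  ∃ G : ℕ → Fin m → BiOp a b →ₗ[ℂ] BiOp a b, (∀ t, IsFiniteLOCC (G t)) ∧
    ∀ j X, Filter.Tendsto (fun t => G t j X) Filter.atTop (nhds (F j X))

/-- `n` uses of `Λ` on `A`, each preceded by a filter. `F h` is the filter (an instrument with
outcomes `j : Fin m`) that is applied when the earlier filters gave the outcomes in the list `h`;
the result is averaged over all outcomes. If `m = 1`, this is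
`(Λ ⊗ id) ∘ F_n ∘ ⋯ ∘ (Λ ⊗ id) ∘ F_1` with a fixed sequence of filters. -/
def chainFrom {a b m : ℕ} (Λ : Op a →ₗ[ℂ] Op a)
    (F : List (Fin m) → Fin m → BiOp a b →ₗ[ℂ] BiOp a b) :
    ℕ → List (Fin m) → BiOp a b →ₗ[ℂ] BiOp a b
  | 0, _ => LinearMap.id
  | n + 1, h => ∑ j, chainFrom Λ F n (h ++ [j]) ∘ₗ onA b Λ ∘ₗ F h j

/-- The overall transformation `Λ_n`. -/
def chain {a b m : ℕ} (Λ : Op a →ₗ[ℂ] Op a)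
    (F : List (Fin m) → Fin m → BiOp a b →ₗ[ℂ] BiOp a b) (n : ℕ) : BiOp a b →ₗ[ℂ] BiOp a b :=
  chainFrom Λ F n []

end

end QNet

namespace QNet

open scoped ComplexOrder MatrixOrder Kronecker
open Matrix

noncomputable section

/-! A bipartite pure state is a coefficient matrix `M`, and its entanglement is measured by the
projective norm of the second exterior power of `M`, whose entries are the two-by-two minors. With
Schmidt coefficients s_q this norm is the sum of s_q s_q' over ordered pairs q ≠ q', i.e. twice the
negativity; `NegLE` bounds it from above through explicit decompositions. It is quadratic in `M`,
hence linear in the weight of an unnormalized pure state, and `EntLE` bounds its convex roof on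
mixed states.

Four facts carry the proof. The measure is at most d_A - 1 on states (`IsState.entLE`). It does not
increase on average under local instruments, hence under finite LOCC (`IsFiniteLOCC.entLE`): for
orthonormal u, v one has ‖Ku ∧ Kv‖ ≤ √2 ‖Ku‖‖Kv‖ ≤ √2 (‖Ku‖² + ‖Kv‖²)/2, and the right-hand sides
sum to √2 = ‖u ∧ v‖ over a trace-preserving Kraus family. It bounds the trace distance to the
separable states, because deleting the off-diagonal Schmidt terms leaves a separable state
(`EntLE.exists_separable`).

Finally, `Λ` shrinks it by a fixed factor c < 1 (`exists_wedgeContracts`). Equality in the estimate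
above for a sufficiently rich Kraus family of `Λ` forces the Knill–Laflamme conditions on the span
of u and v, which would then be correctable; compactness of the set of orthonormal pairs makes the
strict inequality uniform.

Hence n uses leave at most c^n (d_A - 1), and the trace distance is also at most 2; interpolating
these two bounds gives the stated one. General LOCC filters are reached by a limit taken at the
level of trace distances, where compactness of the separable states applies. -/

/-! ### Euclidean norm and trace norm -/

/-- The Euclidean norm of a complex vector. -/
def vnorm {ι : Type} [Fintype ι] (v : ι → ℂ) : ℝ := √(∑ i, ‖v i‖ ^ 2)

lemma vnorm_nonneg {ι : Type} [Fintype ι] (v : ι → ℂ) : 0 ≤ vnorm v := Real.sqrt_nonneg _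

lemma vnorm_sq {ι : Type} [Fintype ι] (v : ι → ℂ) : vnorm v ^ 2 = ∑ i, ‖v i‖ ^ 2 :=
  Real.sq_sqrt (Finset.sum_nonneg fun _ _ => sq_nonneg _)

lemma norm_toLp {ι : Type} [Fintype ι] (v : ι → ℂ) : ‖WithLp.toLp 2 v‖ = vnorm v := by
  rw [EuclideanSpace.norm_eq]; rfl

lemma inner_toLp {ι : Type} [Fintype ι] (v w : ι → ℂ) :
    inner ℂ (WithLp.toLp 2 v) (WithLp.toLp 2 w) = star v ⬝ᵥ w := by
  rw [EuclideanSpace.inner_eq_star_dotProduct, dotProduct_comm]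

lemma norm_dotProduct_le {ι : Type} [Fintype ι] (v w : ι → ℂ) :
    ‖star v ⬝ᵥ w‖ ≤ vnorm v * vnorm w := by
  rw [← inner_toLp, ← norm_toLp, ← norm_toLp]
  exact norm_inner_le_norm _ _

lemma star_dotProduct_self {ι : Type} [Fintype ι] (v : ι → ℂ) :
    star v ⬝ᵥ v = ((vnorm v ^ 2 : ℝ) : ℂ) := by
  rw [vnorm_sq, dotProduct]
  push_cast
  refine Finset.sum_congr rfl fun i _ => ?_
  rw [Pi.star_apply, ← Complex.conj_mul']
  rfl

lemma vnorm_smul {ι : Type} [Fintype ι] (c : ℂ) (v : ι → ℂ) :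
    vnorm (c • v) = ‖c‖ * vnorm v := by
  rw [← norm_toLp, ← norm_toLp, WithLp.toLp_smul, norm_smul]

lemma vnorm_eq_zero {ι : Type} [Fintype ι] {v : ι → ℂ} (h : vnorm v = 0) : v = 0 := by
  rw [← norm_toLp, norm_eq_zero] at h
  simpa using h

/-- The trace norm of a Hermitian matrix is the sum of the moduli of its eigenvalues. -/
lemma traceNorm_eq_sum_abs {ι : Type} [Fintype ι] [DecidableEq ι] {Y : Matrix ι ι ℂ}
    (hY : Y.IsHermitian) : traceNorm Y = ∑ i, |hY.eigenvalues i| := by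
  set U : Matrix ι ι ℂ := hY.eigenvectorUnitary.1
  have hUU : star U * U = 1 := Unitary.coe_star_mul_self _
  have hspec : Y = U * diagonal (fun i => (hY.eigenvalues i : ℂ)) * star U := by
    conv_lhs => rw [hY.spectral_theorem, Unitary.conjStarAlgAut_apply]
    rfl
  have key : CFC.sqrt (Yᴴ * Y) = U * diagonal (fun i => ((|hY.eigenvalues i| : ℝ) : ℂ)) * star U := by
    refine CFC.sqrt_unique ?_ ?_
    · rw [hY.eq]
      conv_rhs => rw [hspec]
      simp only [← Matrix.mul_assoc]
      congr 1
      simp only [Matrix.mul_assoc]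
      congr 1
      simp only [← Matrix.mul_assoc (star U) U, hUU, Matrix.one_mul, diagonal_mul_diagonal]
      congr 1
      ext i
      rw [← Complex.ofReal_mul, ← Complex.ofReal_mul, abs_mul_abs_self]
    · rw [nonneg_iff_posSemidef]
      refine PosSemidef.mul_mul_conjTranspose_same (PosSemidef.diagonal ?_) U
      intro i
      simp
  rw [traceNorm, key, trace_mul_comm, ← Matrix.mul_assoc, hUU, Matrix.one_mul, trace_diagonal]
  simp

/-- Each |λ_i| is at most the sum over t of |⟨u_i, v_t⟩||⟨w_t, u_i⟩| in an eigenbasis u;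
Cauchy–Schwarz over i and Parseval then bound every t separately. Every later trace norm estimate
rests on this. -/
lemma traceNorm_le_of_eq_sum {ι κ : Type} [Fintype ι] [DecidableEq ι] [Fintype κ]
    {Y : Matrix ι ι ℂ} (hY : Y.IsHermitian) (v w : κ → ι → ℂ)
    (h : Y = ∑ t, vecMulVec (v t) (star (w t))) :
    traceNorm Y ≤ ∑ t, vnorm (v t) * vnorm (w t) := by
  rw [traceNorm_eq_sum_abs hY]
  set u := hY.eigenvectorBasis
  have h1 : ∀ i, |hY.eigenvalues i| ≤
      ∑ t, ‖inner ℂ (u i) (WithLp.toLp 2 (v t))‖ * ‖inner ℂ (u i) (WithLp.toLp 2 (w t))‖ := by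
    intro i
    rw [hY.eigenvalues_eq]
    refine (RCLike.abs_re_le_norm _).trans ?_
    generalize hY.eigenvectorBasis i = z
    rw [h, sum_mulVec, dotProduct_sum]
    refine (norm_sum_le _ _).trans (Finset.sum_le_sum fun t _ => le_of_eq ?_)
    rw [vecMulVec_mulVec, dotProduct_smul, op_smul_eq_smul, smul_eq_mul, norm_mul,
      ← inner_toLp, ← inner_toLp, norm_inner_symm z (WithLp.toLp 2 (w t))]
    exact mul_comm _ _
  calc ∑ i, |hY.eigenvalues i| ≤ ∑ i, ∑ t, ‖inner ℂ (u i) (WithLp.toLp 2 (v t))‖ *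
        ‖inner ℂ (u i) (WithLp.toLp 2 (w t))‖ := Finset.sum_le_sum fun i _ => h1 i
    _ = ∑ t, ∑ i, ‖inner ℂ (u i) (WithLp.toLp 2 (v t))‖ *
        ‖inner ℂ (u i) (WithLp.toLp 2 (w t))‖ := Finset.sum_comm
    _ ≤ _ := by
      refine Finset.sum_le_sum fun t _ => (Real.sum_mul_le_sqrt_mul_sqrt _ _ _).trans ?_
      rw [u.sum_sq_norm_inner_right, u.sum_sq_norm_inner_right, Real.sqrt_sq (norm_nonneg _),
        Real.sqrt_sq (norm_nonneg _), norm_toLp, norm_toLp]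

/-- The spectral decomposition attains the preceding bound. Concatenating two such decompositions
gives the triangle inequality. -/
lemma exists_eq_sum_of_isHermitian {ι : Type} [Fintype ι] [DecidableEq ι] {Y : Matrix ι ι ℂ}
    (hY : Y.IsHermitian) : ∃ v w : ι → ι → ℂ, Y = ∑ t, vecMulVec (v t) (star (w t)) ∧
      ∑ t, vnorm (v t) * vnorm (w t) = traceNorm Y := by
  set u := hY.eigenvectorBasis
  refine ⟨fun t => (hY.eigenvalues t : ℂ) • (u t).ofLp, fun t => (u t).ofLp, ?_, ?_⟩
  · ext i j
    conv_lhs => rw [hY.spectral_theorem, Unitary.conjStarAlgAut_apply]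
    rw [Matrix.mul_apply, Matrix.sum_apply]
    refine Finset.sum_congr rfl fun t _ => ?_
    rw [mul_diagonal, vecMulVec_apply, star_apply, hY.eigenvectorUnitary_apply,
      hY.eigenvectorUnitary_apply]
    simp only [Pi.smul_apply, smul_eq_mul, Pi.star_apply, Function.comp_apply, u]
    exact congrArg (· * _) (mul_comm _ _)
  · rw [traceNorm_eq_sum_abs hY]
    refine Finset.sum_congr rfl fun t _ => ?_
    have : vnorm (u t).ofLp = 1 := by rw [← norm_toLp]; exact u.norm_eq_one t
    rw [vnorm_smul, this]
    simp

lemma traceNorm_add_le {ι : Type} [Fintype ι] [DecidableEq ι] {X Y : Matrix ι ι ℂ}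
    (hX : X.IsHermitian) (hY : Y.IsHermitian) : traceNorm (X + Y) ≤ traceNorm X + traceNorm Y := by
  obtain ⟨v, w, h, hs⟩ := exists_eq_sum_of_isHermitian hX
  obtain ⟨v', w', h', hs'⟩ := exists_eq_sum_of_isHermitian hY
  have := traceNorm_le_of_eq_sum (hX.add hY) (Sum.elim v v') (Sum.elim w w') (by
    rw [Fintype.sum_sum_type]
    simp only [Sum.elim_inl, Sum.elim_inr]
    rw [← h, ← h'])
  rw [Fintype.sum_sum_type] at this
  simp only [Sum.elim_inl, Sum.elim_inr] at this
  rwa [hs, hs'] at this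

lemma traceNorm_le_sum_norm {ι : Type} [Fintype ι] [DecidableEq ι] {X : Matrix ι ι ℂ}
    (hX : X.IsHermitian) : traceNorm X ≤ ∑ i, ∑ j, ‖X i j‖ := by
  have := traceNorm_le_of_eq_sum hX (fun p : ι × ι => X p.1 p.2 • Pi.single p.1 (1 : ℂ))
    (fun p : ι × ι => Pi.single p.2 (1 : ℂ)) (by
      ext i j
      rw [Matrix.sum_apply, Fintype.sum_prod_type, Finset.sum_eq_single i, Finset.sum_eq_single j]
      · simp [vecMulVec_apply]
      · intro b _ hb; simp [vecMulVec_apply, hb.symm]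
      · simp
      · intro b _ hb; simp [vecMulVec_apply, hb.symm]
      · simp)
  refine this.trans (le_of_eq ?_)
  rw [Fintype.sum_prod_type]
  have h1 : ∀ i : ι, vnorm (Pi.single i (1 : ℂ)) = 1 := by
    intro i
    rw [← norm_toLp]
    exact (PiLp.norm_single 2 (fun _ => ℂ) i (1 : ℂ)).trans norm_one
  simp [vnorm_smul, h1]

lemma tendsto_traceNorm_zero {ι : Type} [Fintype ι] [DecidableEq ι] {X : ℕ → Matrix ι ι ℂ}
    (hX : ∀ t, (X t).IsHermitian) (h : Filter.Tendsto X Filter.atTop (nhds 0)) :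
    Filter.Tendsto (fun t => traceNorm (X t)) Filter.atTop (nhds 0) := by
  refine squeeze_zero (fun t => ?_) (fun t => traceNorm_le_sum_norm (hX t)) ?_
  · rw [traceNorm_eq_sum_abs (hX t)]
    exact Finset.sum_nonneg fun _ _ => abs_nonneg _
  · have h2 : Filter.Tendsto (fun t => ∑ i, ∑ j, ‖X t i j‖) Filter.atTop
        (nhds (∑ i : ι, ∑ j : ι, ‖(0 : Matrix ι ι ℂ) i j‖)) := by
      refine tendsto_finsetSum _ fun i _ => tendsto_finsetSum _ fun j _ => ?_
      exact ((((continuous_apply j).comp (continuous_apply i)).tendsto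
        (0 : Matrix ι ι ℂ)).comp h).norm
    simpa using h2

/-! ### Compactness of the separable states and nearest separable states -/

/-- In a finite-dimensional space the convex hull of a compact set is compact. -/
lemma isCompact_convexHull_of_isCompact {E : Type} [AddCommGroup E] [Module ℝ E]
    [TopologicalSpace E] [ContinuousAdd E] [ContinuousSMul ℝ E] [FiniteDimensional ℝ E]
    {s : Set E} (hs : IsCompact s) : IsCompact (convexHull ℝ s) := by
  rcases s.eq_empty_or_nonempty with rfl | ⟨s₀, hs₀⟩
  · simp
  -- By Carathéodory this many points always suffice, so the hull is a continuous image of a compact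
  -- set.
  set N := Module.finrank ℝ E + 1
  have hK : IsCompact ((fun p : (Fin N → ℝ) × (Fin N → E) => ∑ i, p.1 i • p.2 i) ''
      (stdSimplex ℝ (Fin N) ×ˢ Set.pi Set.univ fun _ => s)) := by
    refine ((isCompact_stdSimplex ℝ (Fin N)).prod (isCompact_univ_pi fun _ => hs)).image ?_
    fun_prop
  convert hK using 1
  refine Set.Subset.antisymm ?_ ?_
  · intro x hx
    obtain ⟨ι, _, z, w, hz, haff, hw, hw1, rfl⟩ := eq_pos_convex_span_of_mem_convexHull hx
    have hcard : Fintype.card ι ≤ N := haff.card_le_finrank_succ.trans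
      (Nat.succ_le_succ (Submodule.finrank_le _))
    let e : ι → Fin N := fun i => Fin.castLE hcard (Fintype.equivFin ι i)
    have he : Function.Injective e := fun i j h =>
      (Fintype.equivFin ι).injective (Fin.castLE_injective hcard h)
    -- Shorter combinations are padded with weight 0 at the dummy point `s₀`.
    refine ⟨(Function.extend e w 0, Function.extend e z fun _ => s₀), ⟨⟨?_, ?_⟩, ?_⟩, ?_⟩
    · intro i
      by_cases hi : ∃ j, e j = i
      · obtain ⟨j, rfl⟩ := hi
        simpa [he.extend_apply] using (hw j).le
      · simp [Function.extend_apply' _ _ _ hi]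
    · rw [← hw1]
      refine (Fintype.sum_of_injective e he _ _ (fun i hi => ?_) fun i => ?_).symm
      · exact Function.extend_apply' _ _ _ hi
      · exact (he.extend_apply _ _ _).symm
    · intro i _
      by_cases hi : ∃ j, e j = i
      · obtain ⟨j, rfl⟩ := hi
        simpa [he.extend_apply] using hz ⟨j, rfl⟩
      · simpa [Function.extend_apply' _ _ _ hi] using hs₀
    · refine (Fintype.sum_of_injective e he _ _ (fun i hi => ?_) fun i => ?_).symm
      · have : ¬ ∃ j, e j = i := hi
        simp [Function.extend_apply' _ _ _ this]
      · simp [he.extend_apply]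
  · rintro _ ⟨⟨w, z⟩, ⟨hw, hz⟩, rfl⟩
    exact (convex_convexHull ℝ s).sum_mem (fun i _ => hw.1 i) hw.2
      fun i _ => subset_convexHull ℝ s (hz i (Set.mem_univ i))

lemma isClosed_setOf_posSemidef {ι : Type} [Fintype ι] :
    IsClosed {M : Matrix ι ι ℂ | M.PosSemidef} := by
  simp only [posSemidef_iff_dotProduct_mulVec, Set.ofPred_and, Set.ofPred_forall]
  refine IsClosed.inter (isClosed_eq ?_ continuous_id) (isClosed_iInter fun x => ?_)
  · exact continuous_id.matrix_conjTranspose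
  · refine isClosed_Ici.preimage (f := fun M : Matrix ι ι ℂ => star x ⬝ᵥ (M *ᵥ x)) ?_
    exact continuous_const.dotProduct (continuous_id.matrix_mulVec continuous_const)

lemma norm_apply_le_trace {ι : Type} [Fintype ι] {M : Matrix ι ι ℂ} (hM : M.PosSemidef) (i j : ι) :
    ‖M i j‖ ≤ M.trace.re := by
  obtain ⟨m, v, rfl⟩ := posSemidef_iff_eq_sum_vecMulVec.1 hM
  have hle : ∀ (x : ι → ℂ) (k : ι), ‖x k‖ ^ 2 ≤ ∑ l, ‖x l‖ ^ 2 := fun x k =>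
    Finset.single_le_sum (f := fun l => ‖x l‖ ^ 2) (fun _ _ => sq_nonneg _) (Finset.mem_univ k)
  rw [trace_sum, Complex.re_sum, Matrix.sum_apply]
  refine (norm_sum_le _ _).trans (Finset.sum_le_sum fun t _ => ?_)
  rw [trace_vecMulVec, dotProduct_comm, star_dotProduct_self, Complex.ofReal_re, vnorm_sq,
    vecMulVec_apply, norm_mul, Pi.star_apply, norm_star]
  nlinarith [hle (v t) i, hle (v t) j, sq_nonneg (‖v t i‖ - ‖v t j‖)]

lemma isCompact_setOf_isState {ι : Type} [Fintype ι] :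
    IsCompact {M : Matrix ι ι ℂ | IsState M} := by
  have hK : IsCompact (Set.pi Set.univ fun _ : ι => Set.pi Set.univ fun _ : ι =>
      Metric.closedBall (0 : ℂ) 1) :=
    isCompact_univ_pi fun _ => isCompact_univ_pi fun _ => isCompact_closedBall _ _
  refine hK.of_isClosed_subset ?_ ?_
  · exact isClosed_setOf_posSemidef.inter
      (isClosed_eq continuous_id.matrix_trace continuous_const)
  · intro M hM i _ j _
    have := norm_apply_le_trace hM.1 i j
    rw [hM.2] at this
    simpa using this

lemma isCompact_separableStates (a b : ℕ) : IsCompact (separableStates a b) := by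
  refine isCompact_convexHull_of_isCompact ?_
  have : {σ : BiOp a b | ∃ (α : Op a) (β : Op b), IsState α ∧ IsState β ∧ σ = α ⊗ₖ β} =
      (fun p : Op a × Op b => p.1 ⊗ₖ p.2) '' ({α | IsState α} ×ˢ {β | IsState β}) := by
    ext σ
    constructor
    · rintro ⟨α, β, hα, hβ, rfl⟩
      exact ⟨(α, β), ⟨hα, hβ⟩, rfl⟩
    · rintro ⟨⟨α, β⟩, ⟨hα, hβ⟩, rfl⟩
      exact ⟨α, β, hα, hβ, rfl⟩
  rw [this]
  refine (isCompact_setOf_isState.prod isCompact_setOf_isState).image ?_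
  refine continuous_matrix fun i j => ?_
  simp only [kroneckerMap_apply]
  fun_prop

lemma convex_setOf_isState {ι : Type} [Fintype ι] : Convex ℝ {M : Matrix ι ι ℂ | IsState M} := by
  intro x hx y hy s t hs ht hst
  refine ⟨(hx.1.smul hs).add (hy.1.smul ht), ?_⟩
  rw [trace_add, trace_smul, trace_smul, hx.2, hy.2, ← add_smul, hst, one_smul]

lemma isState_of_mem_separableStates {a b : ℕ} {σ : BiOp a b} (hσ : σ ∈ separableStates a b) :
    IsState σ := by
  refine convexHull_min ?_ convex_setOf_isState hσ
  rintro _ ⟨α, β, hα, hβ, rfl⟩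
  refine ⟨hα.1.kronecker hβ.1, ?_⟩
  rw [trace_kronecker, hα.2, hβ.2, one_mul]

/-- A nonempty compact set of Hermitian matrices contains a matrix of minimal trace distance to a
given Hermitian matrix. -/
lemma exists_min_traceNorm_sub {ι : Type} [Fintype ι] [DecidableEq ι] {S : Set (Matrix ι ι ℂ)}
    (hS : IsCompact S) (hne : S.Nonempty) (hherm : ∀ σ ∈ S, σ.IsHermitian) {X : Matrix ι ι ℂ}
    (hX : X.IsHermitian) :
    ∃ σ ∈ S, ∀ τ ∈ S, traceNorm (X - σ) ≤ traceNorm (X - τ) := by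
  have hcont : ContinuousOn (fun σ => traceNorm (X - σ)) S := by
    intro σ hσ
    refine tendsto_iff_norm_sub_tendsto_zero.2 ?_
    have hb : Filter.Tendsto (fun τ : Matrix ι ι ℂ => ∑ i, ∑ j, ‖(σ - τ) i j‖)
        (nhdsWithin σ S) (nhds 0) := by
      have hc : Continuous fun τ : Matrix ι ι ℂ => ∑ i, ∑ j, ‖(σ - τ) i j‖ := by
        refine continuous_finsetSum _ fun i _ => continuous_finsetSum _ fun j _ => ?_
        exact ((continuous_const.sub continuous_id).matrix_elem i j).norm
      have := hc.tendsto σ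
      simp only [sub_self, Matrix.zero_apply, norm_zero, Finset.sum_const_zero] at this
      exact this.mono_left nhdsWithin_le_nhds
    refine squeeze_zero' (Filter.Eventually.of_forall fun _ => norm_nonneg _) ?_ hb
    filter_upwards [self_mem_nhdsWithin] with τ hτ
    have h1 := traceNorm_add_le (hX.sub (hherm σ hσ)) ((hherm σ hσ).sub (hherm τ hτ))
    have h2 := traceNorm_add_le (hX.sub (hherm τ hτ)) ((hherm τ hτ).sub (hherm σ hσ))
    rw [sub_add_sub_cancel] at h1 h2
    have h3 := traceNorm_le_sum_norm ((hherm σ hσ).sub (hherm τ hτ))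
    have h4 := traceNorm_le_sum_norm ((hherm τ hτ).sub (hherm σ hσ))
    have h5 : ∑ i, ∑ j, ‖(τ - σ) i j‖ = ∑ i, ∑ j, ‖(σ - τ) i j‖ := by
      refine Finset.sum_congr rfl fun i _ => Finset.sum_congr rfl fun j _ => ?_
      rw [Matrix.sub_apply, Matrix.sub_apply, norm_sub_rev]
    rw [Real.norm_eq_abs, abs_le]
    constructor <;> linarith
  obtain ⟨σ, hσ, hmin⟩ := hS.exists_isMinOn hne hcont
  exact ⟨σ, hσ, fun τ hτ => hmin hτ⟩

/-! ### Kraus operators of channels and instruments -/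

/-- The unnormalized pure state of the bipartite vector with coefficient matrix `M`. -/
def ketbra {a b : ℕ} (M : Matrix (Fin a) (Fin b) ℂ) : BiOp a b :=
  Matrix.of fun p q => M p.1 p.2 * star (M q.1 q.2)

lemma ketbra_eq_vecMulVec {a b : ℕ} (M : Matrix (Fin a) (Fin b) ℂ) :
    ketbra M = vecMulVec (fun p => M p.1 p.2) (star fun p => M p.1 p.2) := rfl

/-- `K` is a family of Kraus operators of `E`. -/
def IsKraus {a a' : ℕ} {κ : Type} [Fintype κ] (E : Op a →ₗ[ℂ] Op a')
    (K : κ → Matrix (Fin a') (Fin a) ℂ) : Prop :=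
  ∀ X, E X = ∑ s, K s * X * (K s)ᴴ

/-- **Choi's theorem**: completely positive maps have Kraus operators. -/
lemma IsCP.exists_isKraus {a a' : ℕ} {E : Op a →ₗ[ℂ] Op a'} (hE : IsCP E) :
    ∃ (N : ℕ) (K : Fin N → Matrix (Fin a') (Fin a) ℂ), IsKraus E K := by
  -- The Choi matrix: the image of the unnormalized maximally entangled state. Its rank-one
  -- summands, reshaped into matrices, are the Kraus operators.
  have h := hE a _ (posSemidef_vecMulVec_self_star
    (fun p : Fin a × Fin a => if p.1 = p.2 then (1 : ℂ) else 0))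
  obtain ⟨N, v, hv⟩ := posSemidef_iff_eq_sum_vecMulVec.1 h
  refine ⟨N, fun s => Matrix.of fun p k => v s (p, k), fun X => ?_⟩
  have hE1 : ∀ k l p q, E (Matrix.single k l 1) p q = ∑ s, v s (p, k) * star (v s (q, l)) := by
    intro k l p q
    have h2 := congrFun (congrFun hv (p, k)) (q, l)
    rw [Matrix.sum_apply] at h2
    simp only [vecMulVec_apply, Pi.star_apply] at h2
    rw [← h2]
    change E _ p q = E _ p q
    refine congrFun (congrFun (congrArg E ?_) p) q
    ext i j
    simp only [Matrix.single_apply, Matrix.of_apply, vecMulVec_apply, Pi.star_apply]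
    by_cases h1 : i = k <;> by_cases h2 : j = l <;> simp [h1, h2, @eq_comm _ k i, @eq_comm _ l j]
  ext p q
  conv_lhs => rw [matrix_eq_sum_single X]
  have hsingle : ∀ k l, Matrix.single k l (X k l) = X k l • Matrix.single k l (1 : ℂ) := by
    intro k l
    rw [smul_single, smul_eq_mul, mul_one]
  simp only [hsingle, map_sum, map_smul, Matrix.sum_apply, Matrix.smul_apply, hE1, Matrix.mul_apply,
    conjTranspose_apply, Matrix.of_apply, smul_eq_mul, Finset.mul_sum, Finset.sum_mul]
  rw [Finset.sum_congr rfl fun k _ => Finset.sum_comm, Finset.sum_comm]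
  refine Finset.sum_congr rfl fun s _ => ?_
  rw [Finset.sum_comm]
  exact Finset.sum_congr rfl fun l _ => Finset.sum_congr rfl fun k _ => by ring

lemma trace_mul_vecMulVec {a a' : ℕ} (K : Matrix (Fin a') (Fin a) ℂ) (v : Fin a → ℂ) :
    (K * vecMulVec v (star v) * Kᴴ).trace = ((vnorm (K *ᵥ v) ^ 2 : ℝ) : ℂ) := by
  rw [mul_vecMulVec, vecMulVec_mul, ← star_mulVec, trace_vecMulVec, dotProduct_comm,
    star_dotProduct_self]

lemma IsKraus.onA_ketbra {a a' b : ℕ} {κ : Type} [Fintype κ] {E : Op a →ₗ[ℂ] Op a'}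
    {K : κ → Matrix (Fin a') (Fin a) ℂ} (hK : IsKraus E K) (M : Matrix (Fin a) (Fin b) ℂ) :
    onA b E (ketbra M) = ∑ s, ketbra (K s * M) := by
  ext p q
  change E _ p.1 q.1 = _
  rw [hK, Matrix.sum_apply, Matrix.sum_apply]
  refine Finset.sum_congr rfl fun s _ => ?_
  have : (Matrix.of fun i j => ketbra M (i, p.2) (j, q.2)) =
      vecMulVec (fun i => M i p.2) (star fun j => M j q.2) := rfl
  rw [this, mul_vecMulVec, vecMulVec_mul, ← star_mulVec]
  rfl

lemma IsKraus.onB_ketbra {a b b' : ℕ} {κ : Type} [Fintype κ] {E : Op b →ₗ[ℂ] Op b'}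
    {K : κ → Matrix (Fin b') (Fin b) ℂ} (hK : IsKraus E K) (M : Matrix (Fin a) (Fin b) ℂ) :
    onB a E (ketbra M) = ∑ s, ketbra (M * (K s)ᵀ) := by
  ext p q
  change E _ p.2 q.2 = _
  rw [hK, Matrix.sum_apply, Matrix.sum_apply]
  refine Finset.sum_congr rfl fun s _ => ?_
  have : (Matrix.of fun k l => ketbra M (p.1, k) (q.1, l)) =
      vecMulVec (M p.1) (star (M q.1)) := rfl
  rw [this, mul_vecMulVec, vecMulVec_mul, ← star_mulVec, vecMulVec_apply, ← vecMul_transpose,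
    ← vecMul_transpose]
  rfl

lemma trace_onA {a a' b : ℕ} (E : Op a →ₗ[ℂ] Op a') (X : BiOp a b) :
    (onA b E X).trace = ∑ k, (E (Matrix.of fun i j => X (i, k) (j, k))).trace := by
  simp only [Matrix.trace, Matrix.diag, Fintype.sum_prod_type]
  rw [Finset.sum_comm]
  rfl

lemma trace_onB {a b b' : ℕ} (E : Op b →ₗ[ℂ] Op b') (X : BiOp a b) :
    (onB a E X).trace = ∑ i, (E (Matrix.of fun k l => X (i, k) (i, l))).trace := by
  simp only [Matrix.trace, Matrix.diag, Fintype.sum_prod_type]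
  rfl

lemma IsInstrument.sum_trace_onA {a b k : ℕ} {a₁ : Fin k → ℕ} {E : (i : Fin k) → Op a →ₗ[ℂ] Op (a₁ i)}
    (hE : IsInstrument E) (X : BiOp a b) : ∑ i, (onA b (E i) X).trace = X.trace := by
  simp only [trace_onA]
  rw [Finset.sum_comm]
  simp only [hE.2]
  simp only [Matrix.trace, Matrix.diag, Fintype.sum_prod_type, Matrix.of_apply]
  rw [Finset.sum_comm]

lemma IsInstrument.sum_trace_onB {a b k : ℕ} {b₁ : Fin k → ℕ} {E : (i : Fin k) → Op b →ₗ[ℂ] Op (b₁ i)}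
    (hE : IsInstrument E) (X : BiOp a b) : ∑ i, (onB a (E i) X).trace = X.trace := by
  simp only [trace_onB]
  rw [Finset.sum_comm]
  simp only [hE.2]
  simp only [Matrix.trace, Matrix.diag, Fintype.sum_prod_type, Matrix.of_apply]

lemma IsChannel.trace_onA {a a' b : ℕ} {E : Op a →ₗ[ℂ] Op a'} (hE : IsChannel E) (X : BiOp a b) :
    (onA b E X).trace = X.trace := by
  rw [QNet.trace_onA]
  simp only [hE.2]
  simp only [Matrix.trace, Matrix.diag, Fintype.sum_prod_type, Matrix.of_apply]
  rw [Finset.sum_comm]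

/-- Kraus operators of all the outcomes of an instrument. -/
lemma IsInstrument.exists_isKraus {a k : ℕ} {a₁ : Fin k → ℕ}
    {E : (i : Fin k) → Op a →ₗ[ℂ] Op (a₁ i)} (hE : IsInstrument E) :
    ∃ (N : Fin k → ℕ) (K : (i : Fin k) → Fin (N i) → Matrix (Fin (a₁ i)) (Fin a) ℂ),
      (∀ i, IsKraus (E i) (K i)) ∧ ∀ v, ∑ i, ∑ s, vnorm (K i s *ᵥ v) ^ 2 = vnorm v ^ 2 := by
  choose N K hK using fun i => (hE.1 i).exists_isKraus
  refine ⟨N, K, hK, fun v => ?_⟩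
  have h := hE.2 (vecMulVec v (star v))
  simp only [hK _ _, trace_sum, trace_mul_vecMulVec] at h
  rw [trace_vecMulVec, dotProduct_comm, star_dotProduct_self] at h
  exact_mod_cast h

/-! ### Exterior squares and the projective norm of the minors -/

/-- The coordinates of `a ∧ b`. -/
def wedge {n : ℕ} (a b : Fin n → ℂ) : Fin n × Fin n → ℂ := fun p => a p.1 * b p.2 - a p.2 * b p.1

/-- The matrix of two-by-two minors. -/
def minor {a b : ℕ} (M : Matrix (Fin a) (Fin b) ℂ) (p : Fin a × Fin a) (q : Fin b × Fin b) : ℂ :=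
  M p.1 q.1 * M p.2 q.2 - M p.1 q.2 * M p.2 q.1

/-- The projective norm of the second exterior power of `M` is at most `r`. -/
def NegLE {a b : ℕ} (M : Matrix (Fin a) (Fin b) ℂ) (r : ℝ) : Prop :=
  ∃ (T : Type) (_ : Fintype T) (x y : T → Fin a → ℂ) (z w : T → Fin b → ℂ),
    (∀ p q, minor M p q = ∑ t, wedge (x t) (y t) p * wedge (z t) (w t) q) ∧
      ∑ t, vnorm (wedge (x t) (y t)) * vnorm (wedge (z t) (w t)) ≤ r

lemma wedge_mulVec {n m : ℕ} (K : Matrix (Fin m) (Fin n) ℂ) (x y : Fin n → ℂ) (p : Fin m × Fin m) :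
    wedge (K *ᵥ x) (K *ᵥ y) p = ∑ i, ∑ j, K p.1 i * K p.2 j * wedge x y (i, j) := by
  simp only [wedge, mulVec, dotProduct, mul_sub, Finset.sum_sub_distrib, Finset.sum_mul_sum]
  congr 1
  · exact Finset.sum_congr rfl fun i _ => Finset.sum_congr rfl fun j _ => by ring
  · rw [Finset.sum_comm]
    exact Finset.sum_congr rfl fun i _ => Finset.sum_congr rfl fun j _ => by ring

/-- Functoriality of the second exterior power. Summing over ordered pairs needs no factor 1/2, as
only one of the two products is antisymmetrized. -/
lemma minor_mul {a a' b : ℕ} (K : Matrix (Fin a') (Fin a) ℂ) (M : Matrix (Fin a) (Fin b) ℂ)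
    (p : Fin a' × Fin a') (q : Fin b × Fin b) :
    minor (K * M) p q = ∑ i, ∑ j, K p.1 i * K p.2 j * minor M (i, j) q := by
  simp only [minor, Matrix.mul_apply, mul_sub, Finset.sum_sub_distrib, Finset.sum_mul_sum]
  congr 1
  · exact Finset.sum_congr rfl fun i _ => Finset.sum_congr rfl fun j _ => by ring
  · exact Finset.sum_congr rfl fun i _ => Finset.sum_congr rfl fun j _ => by ring

lemma NegLE.transpose {a b : ℕ} {M : Matrix (Fin a) (Fin b) ℂ} {r : ℝ} (h : NegLE M r) :
    NegLE Mᵀ r := by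
  obtain ⟨T, _, x, y, z, w, h1, h2⟩ := h
  refine ⟨T, inferInstance, z, w, x, y, fun p q => ?_, ?_⟩
  · have h3 : minor Mᵀ p q = minor M q p := by
      simp only [minor, transpose_apply]
      ring
    rw [h3, h1]
    exact Finset.sum_congr rfl fun t _ => mul_comm _ _
  · simpa only [mul_comm] using h2

/-- Lagrange's identity. The factor 2 appears because coordinates are indexed by all ordered pairs,
so an orthonormal pair has wedge norm √2. -/
lemma vnorm_wedge_sq {n : ℕ} (x y : Fin n → ℂ) :
    vnorm (wedge x y) ^ 2 = 2 * (vnorm x ^ 2 * vnorm y ^ 2 - ‖star x ⬝ᵥ y‖ ^ 2) := by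
  have key : ((vnorm (wedge x y) ^ 2 : ℝ) : ℂ) =
      ((2 * (vnorm x ^ 2 * vnorm y ^ 2 - ‖star x ⬝ᵥ y‖ ^ 2) : ℝ) : ℂ) := by
    have hxy : ((‖star x ⬝ᵥ y‖ ^ 2 : ℝ) : ℂ) = (star x ⬝ᵥ y) * (star y ⬝ᵥ x) := by
      push_cast
      rw [← Complex.mul_conj', starRingEnd_apply, ← star_dotProduct]
    rw [← star_dotProduct_self]
    simp only [Complex.ofReal_mul, Complex.ofReal_sub, hxy, ← star_dotProduct_self]
    simp only [dotProduct, Pi.star_apply, wedge, Fintype.sum_prod_type, Finset.sum_mul_sum, star_sub,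
      star_mul', Complex.ofReal_ofNat]
    have e1 : ∑ i, ∑ j, star (x i) * x i * (star (y j) * y j) =
        ∑ i, ∑ j, star (x j) * x j * (star (y i) * y i) := Finset.sum_comm
    have e2 : ∑ i, ∑ j, star (x i) * y i * (star (y j) * x j) =
        ∑ i, ∑ j, star (x j) * y j * (star (y i) * x i) := Finset.sum_comm
    rw [two_mul]
    nth_rw 2 [e1]
    nth_rw 2 [e2]
    simp only [← Finset.sum_add_distrib, ← Finset.sum_sub_distrib]
    exact Finset.sum_congr rfl fun i _ => Finset.sum_congr rfl fun j _ => by ring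
  exact_mod_cast key

lemma vnorm_wedge_le {n : ℕ} (x y : Fin n → ℂ) :
    vnorm (wedge x y) ≤ √2 * (vnorm x * vnorm y) := by
  refine abs_le_of_sq_le_sq' ?_ (by have := vnorm_nonneg x; have := vnorm_nonneg y; positivity) |>.2
  rw [vnorm_wedge_sq, mul_pow, Real.sq_sqrt zero_le_two, mul_pow]
  nlinarith [sq_nonneg ‖star x ⬝ᵥ y‖]

/-- Gram–Schmidt for two vectors, at the level of `x ∧ y`. -/
lemma exists_orthonormal_wedge {n : ℕ} (x y : Fin n → ℂ) :
    (∀ (m : ℕ) (K : Matrix (Fin m) (Fin n) ℂ), wedge (K *ᵥ x) (K *ᵥ y) = 0) ∨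
    ∃ (u v : Fin n → ℂ) (c : ℝ), 0 ≤ c ∧ vnorm u = 1 ∧ vnorm v = 1 ∧ star u ⬝ᵥ v = 0 ∧
      vnorm (wedge x y) = c * √2 ∧
      ∀ (m : ℕ) (K : Matrix (Fin m) (Fin n) ℂ),
        wedge (K *ᵥ x) (K *ᵥ y) = (c : ℂ) • wedge (K *ᵥ u) (K *ᵥ v) := by
  by_cases hx : vnorm x = 0
  · left
    intro m K
    rw [vnorm_eq_zero hx, mulVec_zero]
    ext p
    simp [wedge]
  set z : Fin n → ℂ := y - ((star x ⬝ᵥ y) / (vnorm x ^ 2 : ℝ)) • x with hz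
  have hwz : ∀ (m : ℕ) (K : Matrix (Fin m) (Fin n) ℂ),
      wedge (K *ᵥ x) (K *ᵥ y) = wedge (K *ᵥ x) (K *ᵥ z) := by
    intro m K
    ext p
    simp only [hz, mulVec_sub, mulVec_smul, wedge, Pi.sub_apply, Pi.smul_apply, smul_eq_mul]
    ring
  have hxz : star x ⬝ᵥ z = 0 := by
    rw [hz, dotProduct_sub, dotProduct_smul, star_dotProduct_self, smul_eq_mul, div_mul_cancel₀,
      sub_self]
    exact_mod_cast pow_ne_zero 2 hx
  by_cases hz0 : vnorm z = 0
  · left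
    intro m K
    rw [hwz, vnorm_eq_zero hz0, mulVec_zero]
    ext p
    simp [wedge]
  right
  have hsc : ∀ (m : ℕ) (K : Matrix (Fin m) (Fin n) ℂ), wedge (K *ᵥ x) (K *ᵥ z) =
      ((vnorm x * vnorm z : ℝ) : ℂ) • wedge (K *ᵥ (((vnorm x)⁻¹ : ℝ) : ℂ) • x)
        (K *ᵥ (((vnorm z)⁻¹ : ℝ) : ℂ) • z) := by
    intro m K
    have hx' : (vnorm x : ℂ) ≠ 0 := by exact_mod_cast hx
    have hz' : (vnorm z : ℂ) ≠ 0 := by exact_mod_cast hz0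
    ext p
    simp only [mulVec_smul, wedge, Pi.smul_apply, smul_eq_mul]
    push_cast
    field_simp
  have hunit : ∀ w : Fin n → ℂ, vnorm w ≠ 0 → vnorm ((((vnorm w)⁻¹ : ℝ) : ℂ) • w) = 1 := by
    intro w hw
    rw [vnorm_smul, Complex.norm_real, Real.norm_of_nonneg (inv_nonneg.2 (vnorm_nonneg w)),
      inv_mul_cancel₀ hw]
  have horth : star ((((vnorm x)⁻¹ : ℝ) : ℂ) • x) ⬝ᵥ ((((vnorm z)⁻¹ : ℝ) : ℂ) • z) = 0 := by
    rw [star_smul, smul_dotProduct, dotProduct_smul, hxz, smul_zero, smul_zero]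
  refine ⟨_, _, vnorm x * vnorm z, mul_nonneg (vnorm_nonneg _) (vnorm_nonneg _), hunit x hx,
    hunit z hz0, horth, ?_, fun m K => (hwz m K).trans (hsc m K)⟩
  -- Taking `K` to be the identity transfers the relation to `wedge x y` itself.
  have h1 := hwz n 1
  rw [one_mulVec, one_mulVec, one_mulVec] at h1
  rw [h1, ← Real.sqrt_sq (vnorm_nonneg _), vnorm_wedge_sq, hxz, norm_zero,
    ← Real.sqrt_sq (mul_nonneg (vnorm_nonneg x) (vnorm_nonneg z)), ← Real.sqrt_mul (sq_nonneg _)]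
  congr 1
  ring

/-- A family of operators shrinks `x ∧ y` on average by the factor `c`. -/
def WedgeContracts {n : ℕ} {κ : Type} [Fintype κ] {d : κ → ℕ}
    (K : (s : κ) → Matrix (Fin (d s)) (Fin n) ℂ) (c : ℝ) : Prop :=
  ∀ x y, ∑ s, vnorm (wedge (K s *ᵥ x) (K s *ᵥ y)) ≤ c * vnorm (wedge x y)

lemma wedgeContracts_of_orthonormal {n : ℕ} {κ : Type} [Fintype κ] {d : κ → ℕ}
    (K : (s : κ) → Matrix (Fin (d s)) (Fin n) ℂ) {c : ℝ} (hc : 0 ≤ c)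
    (h : ∀ u v, vnorm u = 1 → vnorm v = 1 → star u ⬝ᵥ v = 0 →
      ∑ s, vnorm (wedge (K s *ᵥ u) (K s *ᵥ v)) ≤ c * √2) : WedgeContracts K c := by
  intro x y
  rcases exists_orthonormal_wedge x y with h0 | ⟨u, v, e, he, hu, hv, huv, hn, hK⟩
  · have : ∀ m, vnorm (0 : Fin m × Fin m → ℂ) = 0 := fun m => by simp [vnorm]
    simp only [h0, this, Finset.sum_const_zero]
    exact mul_nonneg hc (vnorm_nonneg _)
  · simp only [hK, vnorm_smul, Complex.norm_real, Real.norm_of_nonneg he, ← Finset.mul_sum, hn]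
    have := mul_le_mul_of_nonneg_left (h u v hu hv huv) he
    linarith

/-- On an orthonormal pair, the AM–GM inequality turns each wedge norm into squared norms, which sum
to 1 for each of the two vectors. -/
lemma wedgeContracts_one {n : ℕ} {κ : Type} [Fintype κ] {d : κ → ℕ}
    (K : (s : κ) → Matrix (Fin (d s)) (Fin n) ℂ)
    (hK : ∀ v, ∑ s, vnorm (K s *ᵥ v) ^ 2 = vnorm v ^ 2) : WedgeContracts K 1 := by
  refine wedgeContracts_of_orthonormal K zero_le_one fun u v hu hv _ => ?_
  have h1 : ∀ s, vnorm (wedge (K s *ᵥ u) (K s *ᵥ v)) ≤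
      √2 * ((vnorm (K s *ᵥ u) ^ 2 + vnorm (K s *ᵥ v) ^ 2) / 2) := fun s =>
    (vnorm_wedge_le _ _).trans (mul_le_mul_of_nonneg_left
      (by nlinarith [sq_nonneg (vnorm (K s *ᵥ u) - vnorm (K s *ᵥ v))]) (Real.sqrt_nonneg 2))
  refine (Finset.sum_le_sum fun s _ => h1 s).trans (le_of_eq ?_)
  rw [← Finset.mul_sum, ← Finset.sum_div, Finset.sum_add_distrib, hK, hK, hu, hv]
  ring

/-- Multiplying `M` by `K s` on the left acts only on the left wedges of a decomposition of its
minors, so the same right wedges serve for every `s` and the contraction applies term by term. -/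
lemma NegLE.exists_mul {a b : ℕ} {κ : Type} [Fintype κ] {d : κ → ℕ}
    {K : (s : κ) → Matrix (Fin (d s)) (Fin a) ℂ} {c : ℝ} (hK : WedgeContracts K c)
    {M : Matrix (Fin a) (Fin b) ℂ} {r : ℝ} (hc : 0 ≤ c) (hM : NegLE M r) :
    ∃ r' : κ → ℝ, (∀ s, NegLE (K s * M) (r' s)) ∧ ∑ s, r' s ≤ c * r := by
  obtain ⟨T, _, x, y, z, w, h1, h2⟩ := hM
  refine ⟨fun s => ∑ t, vnorm (wedge (K s *ᵥ x t) (K s *ᵥ y t)) * vnorm (wedge (z t) (w t)),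
    fun s => ⟨T, inferInstance, fun t => K s *ᵥ x t, fun t => K s *ᵥ y t, z, w, fun p q => ?_,
      le_rfl⟩, ?_⟩
  · simp only [minor_mul, h1, wedge_mulVec, Finset.mul_sum, Finset.sum_mul]
    rw [Finset.sum_congr rfl fun i _ => Finset.sum_comm, Finset.sum_comm]
    exact Finset.sum_congr rfl fun t _ => Finset.sum_congr rfl fun i _ =>
      Finset.sum_congr rfl fun j _ => by ring
  · rw [Finset.sum_comm]
    refine le_trans ?_ (mul_le_mul_of_nonneg_left h2 hc)
    rw [Finset.mul_sum]
    refine Finset.sum_le_sum fun t _ => ?_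
    rw [← Finset.sum_mul, ← mul_assoc]
    exact mul_le_mul_of_nonneg_right (hK _ _) (vnorm_nonneg _)

/-! ### The convex roof and its monotonicity under LOCC -/

/-- `X` is a sum of pure states whose negativities add up to at most `r`. -/
def EntLE {a b : ℕ} (X : BiOp a b) (r : ℝ) : Prop :=
  ∃ (κ : Type) (_ : Fintype κ) (M : κ → Matrix (Fin a) (Fin b) ℂ) (e : κ → ℝ),
    X = ∑ s, ketbra (M s) ∧ (∀ s, NegLE (M s) (e s)) ∧ ∑ s, e s ≤ r

lemma EntLE.mono {a b : ℕ} {X : BiOp a b} {r r' : ℝ} (h : EntLE X r) (hr : r ≤ r') :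
    EntLE X r' := by
  obtain ⟨κ, _, M, e, h1, h2, h3⟩ := h
  exact ⟨κ, inferInstance, M, e, h1, h2, h3.trans hr⟩

lemma EntLE.zero {a b : ℕ} : EntLE (0 : BiOp a b) 0 :=
  ⟨Empty, inferInstance, fun s => s.elim, fun s => s.elim, by simp, fun s => s.elim, by simp⟩

lemma EntLE.sum {a b : ℕ} {ι : Type} [Fintype ι] {X : ι → BiOp a b} {r : ι → ℝ}
    (h : ∀ i, EntLE (X i) (r i)) : EntLE (∑ i, X i) (∑ i, r i) := by
  choose κ _ M e h1 h2 h3 using h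
  refine ⟨Σ i, κ i, inferInstance, fun s => M s.1 s.2, fun s => e s.1 s.2, ?_, fun s => h2 _ _, ?_⟩
  · rw [Fintype.sum_sigma]
    exact Finset.sum_congr rfl fun i _ => h1 i
  · rw [Fintype.sum_sigma]
    exact Finset.sum_le_sum fun i _ => h3 i

lemma ketbra_entLE {a b : ℕ} {M : Matrix (Fin a) (Fin b) ℂ} {r : ℝ} (h : NegLE M r) :
    EntLE (ketbra M) r :=
  ⟨Unit, inferInstance, fun _ => M, fun _ => r, by simp, fun _ => h, by simp⟩

/-- The bound is distributed over the outcomes rather than stated for their sum, since later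
operations may depend on the outcome. -/
lemma IsInstrument.entLE_onA {a b k : ℕ} {a₁ : Fin k → ℕ} {E : (i : Fin k) → Op a →ₗ[ℂ] Op (a₁ i)}
    (hE : IsInstrument E) {X : BiOp a b} {r : ℝ} (hX : EntLE X r) :
    ∃ r' : Fin k → ℝ, (∀ i, EntLE (onA b (E i) X) (r' i)) ∧ ∑ i, r' i ≤ r := by
  obtain ⟨N, K, hK, hKn⟩ := hE.exists_isKraus
  obtain ⟨κ, _, M, e, rfl, h2, h3⟩ := hX
  have hW : WedgeContracts (κ := Σ i, Fin (N i)) (fun s => K s.1 s.2) 1 :=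
    wedgeContracts_one _ fun v => by rw [Fintype.sum_sigma]; exact hKn v
  choose e' he' hs using fun x => NegLE.exists_mul hW zero_le_one (h2 x)
  refine ⟨fun i => ∑ x, ∑ s, e' x ⟨i, s⟩, fun i => ?_, ?_⟩
  · rw [map_sum]
    refine EntLE.sum fun x => ?_
    rw [(hK i).onA_ketbra]
    exact EntLE.sum fun s => ketbra_entLE (he' x ⟨i, s⟩)
  · rw [Finset.sum_comm]
    refine le_trans (Finset.sum_le_sum fun x _ => ?_) h3
    have := hs x
    rwa [Fintype.sum_sigma, one_mul] at this

/-- Acting on the second factor multiplies `M` on the right by a transposed Kraus operator; the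
minors of a transpose have the same projective norm, so this is the previous case. -/
lemma IsInstrument.entLE_onB {a b k : ℕ} {b₁ : Fin k → ℕ} {E : (i : Fin k) → Op b →ₗ[ℂ] Op (b₁ i)}
    (hE : IsInstrument E) {X : BiOp a b} {r : ℝ} (hX : EntLE X r) :
    ∃ r' : Fin k → ℝ, (∀ i, EntLE (onB a (E i) X) (r' i)) ∧ ∑ i, r' i ≤ r := by
  obtain ⟨N, K, hK, hKn⟩ := hE.exists_isKraus
  obtain ⟨κ, _, M, e, rfl, h2, h3⟩ := hX
  have hW : WedgeContracts (κ := Σ i, Fin (N i)) (fun s => K s.1 s.2) 1 :=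
    wedgeContracts_one _ fun v => by rw [Fintype.sum_sigma]; exact hKn v
  choose e' he' hs using fun x => NegLE.exists_mul hW zero_le_one (h2 x).transpose
  refine ⟨fun i => ∑ x, ∑ s, e' x ⟨i, s⟩, fun i => ?_, ?_⟩
  · rw [map_sum]
    refine EntLE.sum fun x => ?_
    rw [(hK i).onB_ketbra]
    refine EntLE.sum fun s => ketbra_entLE ?_
    have := (he' x ⟨i, s⟩).transpose
    rwa [transpose_mul, transpose_transpose] at this
  · rw [Finset.sum_comm]
    refine le_trans (Finset.sum_le_sum fun x _ => ?_) h3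
    have := hs x
    rwa [Fintype.sum_sigma, one_mul] at this

lemma IsKraus.entLE_onA {a a' b : ℕ} {κ : Type} [Fintype κ] {E : Op a →ₗ[ℂ] Op a'}
    {K : κ → Matrix (Fin a') (Fin a) ℂ} (hK : IsKraus E K) {c : ℝ} (hc : 0 ≤ c)
    (hW : WedgeContracts K c) {X : BiOp a b} {r : ℝ} (hX : EntLE X r) :
    EntLE (onA b E X) (c * r) := by
  obtain ⟨κ', _, M, e, rfl, h2, h3⟩ := hX
  choose e' he' hs using fun x => NegLE.exists_mul hW hc (h2 x)
  refine EntLE.mono (r := ∑ x, ∑ s, e' x s) ?_ ?_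
  · rw [map_sum]
    refine EntLE.sum fun x => ?_
    rw [hK.onA_ketbra]
    exact EntLE.sum fun s => ketbra_entLE (he' x s)
  · refine (Finset.sum_le_sum fun x _ => hs x).trans ?_
    rw [← Finset.mul_sum]
    exact mul_le_mul_of_nonneg_left h3 hc

lemma IsFiniteLOCC.entLE {a b a' b' m : ℕ} {G : Fin m → BiOp a b →ₗ[ℂ] BiOp a' b'}
    (hG : IsFiniteLOCC G) {X : BiOp a b} {r : ℝ} (hX : EntLE X r) :
    ∃ r' : Fin m → ℝ, (∀ j, EntLE (G j X) (r' j)) ∧ ∑ j, r' j ≤ r := by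
  induction hG generalizing r with
  | declare j₀ =>
    refine ⟨fun j => if j = j₀ then r else 0, fun j => ?_, by simp⟩
    by_cases hj : j = j₀
    · simpa [hj] using hX
    · simpa [hj] using EntLE.zero
  | alice a₁ E hE G _ ih =>
    obtain ⟨e, he, hes⟩ := hE.entLE_onA hX
    choose e' he' hs using fun i => ih i (he i)
    refine ⟨fun j => ∑ i, e' i j, fun j => ?_, ?_⟩
    · rw [LinearMap.sum_apply]
      exact EntLE.sum fun i => he' i j
    · rw [Finset.sum_comm]
      exact (Finset.sum_le_sum fun i _ => hs i).trans hes
  | bob b₁ E hE G _ ih =>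
    obtain ⟨e, he, hes⟩ := hE.entLE_onB hX
    choose e' he' hs using fun i => ih i (he i)
    refine ⟨fun j => ∑ i, e' i j, fun j => ?_, ?_⟩
    · rw [LinearMap.sum_apply]
      exact EntLE.sum fun i => he' i j
    · rw [Finset.sum_comm]
      exact (Finset.sum_le_sum fun i _ => hs i).trans hes

lemma IsFiniteLOCC.sum_trace {a b a' b' m : ℕ} {G : Fin m → BiOp a b →ₗ[ℂ] BiOp a' b'}
    (hG : IsFiniteLOCC G) (X : BiOp a b) : ∑ j, (G j X).trace = X.trace := by
  induction hG with
  | declare j₀ =>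
    rw [Finset.sum_eq_single j₀]
    · simp
    · intro j _ hj; simp [hj]
    · simp
  | alice a₁ E hE G _ ih =>
    simp only [LinearMap.sum_apply, trace_sum, LinearMap.comp_apply]
    rw [Finset.sum_comm]
    simp only [ih, hE.sum_trace_onA]
  | bob b₁ E hE G _ ih =>
    simp only [LinearMap.sum_apply, trace_sum, LinearMap.comp_apply]
    rw [Finset.sum_comm]
    simp only [ih, hE.sum_trace_onB]

/-! ### Schmidt decomposition and the distance to the separable states -/

lemma wedgeContracts_of_contraction {n m : ℕ} (K : Matrix (Fin m) (Fin n) ℂ)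
    (hK : ∀ v, vnorm (K *ᵥ v) ≤ vnorm v) : WedgeContracts (fun _ : Unit => K) 1 := by
  refine wedgeContracts_of_orthonormal _ zero_le_one fun u v hu hv _ => ?_
  rw [Fintype.sum_unique, one_mul]
  refine (vnorm_wedge_le _ _).trans (mul_le_of_le_one_right (Real.sqrt_nonneg 2) ?_)
  exact mul_le_one₀ ((hK u).trans hu.le) (vnorm_nonneg _) ((hK v).trans hv.le)

lemma NegLE.mul_of_contraction {a a' b : ℕ} {K : Matrix (Fin a') (Fin a) ℂ}
    (hK : ∀ v, vnorm (K *ᵥ v) ≤ vnorm v) {M : Matrix (Fin a) (Fin b) ℂ} {r : ℝ} (hM : NegLE M r) :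
    NegLE (K * M) r := by
  obtain ⟨e, he, hs⟩ := NegLE.exists_mul (wedgeContracts_of_contraction K hK) zero_le_one hM
  rw [Fintype.sum_unique, one_mul] at hs
  obtain ⟨T, _, x, y, z, w, h1, h2⟩ := he ()
  exact ⟨T, inferInstance, x, y, z, w, h1, h2.trans hs⟩

lemma sum_norm_mul_le {ι : Type} [Fintype ι] (v w : ι → ℂ) :
    ∑ i, ‖v i‖ * ‖w i‖ ≤ vnorm v * vnorm w :=
  Real.sum_mul_le_sqrt_mul_sqrt _ _ _

/-- The trace is bounded by the projective norm. On a nonnegative diagonal matrix it recovers the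
exact value, which is how a lower bound on the measure is obtained. -/
lemma NegLE.norm_sum_minor_le {n : ℕ} {M : Matrix (Fin n) (Fin n) ℂ} {r : ℝ} (hM : NegLE M r) :
    ‖∑ p, minor M p p‖ ≤ r := by
  obtain ⟨T, _, x, y, z, w, h1, h2⟩ := hM
  simp only [h1]
  rw [Finset.sum_comm]
  refine (norm_sum_le _ _).trans ((Finset.sum_le_sum fun t _ => ?_).trans h2)
  refine (norm_sum_le _ _).trans ?_
  simp only [norm_mul]
  exact sum_norm_mul_le _ _

lemma NegLE.sum_diagonal_le {n : ℕ} {D : Fin n → ℝ} {r : ℝ}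
    (h : NegLE (diagonal fun q => (D q : ℂ)) r) :
    ∑ q, ∑ q', (if q = q' then 0 else D q * D q') ≤ r := by
  have key : ∑ p : Fin n × Fin n, minor (diagonal fun q => (D q : ℂ)) p p =
      ((∑ q, ∑ q', (if q = q' then 0 else D q * D q') : ℝ) : ℂ) := by
    rw [Fintype.sum_prod_type]
    push_cast
    refine Finset.sum_congr rfl fun q _ => Finset.sum_congr rfl fun q' _ => ?_
    by_cases hq : q = q'
    · simp [minor, hq]
    · simp [minor, hq]
  have := h.norm_sum_minor_le
  rw [key, Complex.norm_real] at this
  exact (le_abs_self _).trans this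

/-- A partial isometry is a contraction. -/
lemma vnorm_conjTranspose_mulVec_le {m n : ℕ} {U : Matrix (Fin m) (Fin n) ℂ}
    (hU : U * (Uᴴ * U) = U) (v : Fin m → ℂ) : vnorm (Uᴴ *ᵥ v) ≤ vnorm v := by
  have hadj : ∀ x : Fin n → ℂ, star v ⬝ᵥ (U *ᵥ x) = star (Uᴴ *ᵥ v) ⬝ᵥ x := by
    intro x
    rw [star_mulVec, conjTranspose_conjTranspose, dotProduct_mulVec]
  -- `U` is isometric on the range of `Uᴴ`, so ‖Uᴴv‖² = ⟨v, UUᴴv⟩ ≤ ‖v‖‖Uᴴv‖.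
  have h1 : vnorm (U *ᵥ (Uᴴ *ᵥ v)) ^ 2 = vnorm (Uᴴ *ᵥ v) ^ 2 := by
    have h2 := star_dotProduct_self (U *ᵥ (Uᴴ *ᵥ v))
    rw [star_mulVec, ← dotProduct_mulVec, mulVec_mulVec, mulVec_mulVec, star_mulVec,
      conjTranspose_conjTranspose, ← dotProduct_mulVec, mulVec_mulVec,
      show U * (Uᴴ * U * Uᴴ) = U * Uᴴ by rw [← Matrix.mul_assoc, hU],
      ← mulVec_mulVec, hadj, star_dotProduct_self] at h2
    exact_mod_cast h2.symm
  have h3 := norm_dotProduct_le v (U *ᵥ (Uᴴ *ᵥ v))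
  rw [hadj, star_dotProduct_self, Complex.norm_real, Real.norm_of_nonneg (sq_nonneg _)] at h3
  have h4 : vnorm (U *ᵥ (Uᴴ *ᵥ v)) = vnorm (Uᴴ *ᵥ v) :=
    (sq_eq_sq₀ (vnorm_nonneg _) (vnorm_nonneg _)).1 h1
  rw [h4, sq] at h3
  rcases (vnorm_nonneg (Uᴴ *ᵥ v)).eq_or_lt with h0 | h0
  · rw [← h0]; exact vnorm_nonneg v
  · exact le_of_mul_le_mul_right h3 h0

lemma vnorm_tensor {a b : ℕ} (x : Fin a → ℂ) (g : Fin b → ℂ) :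
    vnorm (fun p : Fin a × Fin b => x p.1 * g p.2) = vnorm x * vnorm g := by
  rw [vnorm, vnorm, vnorm, ← Real.sqrt_mul (Finset.sum_nonneg fun _ _ => sq_nonneg _),
    Finset.sum_mul_sum, Fintype.sum_prod_type]
  simp only [norm_mul, mul_pow]

lemma trace_ketbra {a b : ℕ} (M : Matrix (Fin a) (Fin b) ℂ) :
    (ketbra M).trace = ((vnorm (fun p : Fin a × Fin b => M p.1 p.2) ^ 2 : ℝ) : ℂ) := by
  rw [ketbra_eq_vecMulVec, trace_vecMulVec, dotProduct_comm, star_dotProduct_self]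

/-- The Schmidt decomposition, with a bound on the Schmidt coefficients in terms of the second
exterior power. -/
lemma NegLE.exists_schmidt {a b : ℕ} {M : Matrix (Fin a) (Fin b) ℂ} {r : ℝ} (hM : NegLE M r) :
    ∃ (x : Fin b → Fin a → ℂ) (g : Fin b → Fin b → ℂ),
      (∀ i k, M i k = ∑ q, x q i * g q k) ∧ (∀ q, vnorm (g q) = 1) ∧
      ∑ q, vnorm (x q) ^ 2 = vnorm (fun p : Fin a × Fin b => M p.1 p.2) ^ 2 ∧
      ∑ q, ∑ q', (if q = q' then 0 else vnorm (x q) * vnorm (x q')) ≤ r := by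
  have hH : (Mᴴ * M).IsHermitian := isHermitian_conjTranspose_mul_self M
  set V : Matrix (Fin b) (Fin b) ℂ := hH.eigenvectorUnitary.1
  have hVV : Vᴴ * V = 1 := Unitary.coe_star_mul_self _
  have hVV' : V * Vᴴ = 1 := Unitary.coe_mul_star_self _
  obtain ⟨ev, hspec⟩ : ∃ ev : Fin b → ℂ, Mᴴ * M = V * diagonal ev * Vᴴ := by
    refine ⟨fun i => (hH.eigenvalues i : ℂ), ?_⟩
    conv_lhs => rw [hH.spectral_theorem, Unitary.conjStarAlgAut_apply]
    rfl
  set X := M * V with hX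
  have hMX : M = X * Vᴴ := by rw [hX, Matrix.mul_assoc, hVV', Matrix.mul_one]
  set x : Fin b → Fin a → ℂ := fun q i => X i q
  have hXX : Xᴴ * X = diagonal fun q => ((vnorm (x q) ^ 2 : ℝ) : ℂ) := by
    have h1 : Xᴴ * X = diagonal ev := by
      rw [hX, conjTranspose_mul, Matrix.mul_assoc, ← Matrix.mul_assoc Mᴴ, hspec]
      simp only [Matrix.mul_assoc]
      rw [hVV, Matrix.mul_one, ← Matrix.mul_assoc, hVV, Matrix.one_mul]
    ext q q'
    by_cases hq : q = q'
    · subst hq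
      rw [diagonal_apply_eq, ← star_dotProduct_self]
      rfl
    · rw [diagonal_apply_ne _ hq, h1, diagonal_apply_ne _ hq]
  have hnorm : ∀ q, vnorm (fun k => star (V k q)) = 1 := by
    intro q
    have h1 := congrFun (congrFun hVV q) q
    rw [one_apply_eq, Matrix.mul_apply] at h1
    have h2 : ((vnorm (fun k => star (V k q)) ^ 2 : ℝ) : ℂ) = 1 := by
      rw [← star_dotProduct_self, ← h1]
      refine Finset.sum_congr rfl fun k _ => ?_
      simp [mul_comm]
    exact (pow_eq_one_iff_of_nonneg (vnorm_nonneg _) two_ne_zero).1 (by exact_mod_cast h2)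
  refine ⟨x, fun q k => star (V k q), fun i k => ?_, hnorm, ?_, ?_⟩
  · conv_lhs => rw [hMX]
    rfl
  · have h1 : (Mᴴ * M).trace = (Xᴴ * X).trace := by
      conv_lhs => rw [hMX, conjTranspose_mul, conjTranspose_conjTranspose, Matrix.mul_assoc,
        trace_mul_comm, Matrix.mul_assoc, Matrix.mul_assoc, hVV, Matrix.mul_one]
    have h2 : (Mᴴ * M).trace = (ketbra M).trace := by
      simp only [Matrix.trace, Matrix.diag, Matrix.mul_apply, conjTranspose_apply,
        Fintype.sum_prod_type, ketbra, Matrix.of_apply]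
      rw [Finset.sum_comm]
      exact Finset.sum_congr rfl fun i _ => Finset.sum_congr rfl fun k _ => mul_comm _ _
    have h3 := trace_ketbra M
    rw [← h2, h1, hXX, trace_diagonal] at h3
    exact_mod_cast h3
  -- The polar part of `X`. Since 0⁻¹ = 0, vanishing columns stay zero and `U` is a partial
  -- isometry. Multiplying `M` by the contractions `Uᴴ` and `V` yields the diagonal matrix of
  -- Schmidt coefficients.
  · set U : Matrix (Fin a) (Fin b) ℂ := X * diagonal (fun q => (((vnorm (x q))⁻¹ : ℝ) : ℂ)) with hU
    have hUU : U * (Uᴴ * U) = U := by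
      rw [hU, conjTranspose_mul, diagonal_conjTranspose, Matrix.mul_assoc,
        Matrix.mul_assoc (diagonal _) Xᴴ, ← Matrix.mul_assoc Xᴴ, hXX]
      simp only [diagonal_mul_diagonal]
      congr 2
      ext q
      simp only [Pi.star_apply, Complex.star_def, Complex.conj_ofReal]
      by_cases hq : vnorm (x q) = 0
      · simp [hq]
      · norm_cast
        field_simp
    have hUMV : Uᴴ * (M * V) = diagonal fun q => (vnorm (x q) : ℂ) := by
      rw [← hX, hU, conjTranspose_mul, Matrix.mul_assoc, hXX, diagonal_conjTranspose,
        diagonal_mul_diagonal]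
      congr 1
      ext q
      simp only [Pi.star_apply, Complex.star_def, Complex.conj_ofReal]
      by_cases hq : vnorm (x q) = 0
      · simp [hq]
      · norm_cast
        field_simp
    refine NegLE.sum_diagonal_le (D := fun q => vnorm (x q)) ?_
    rw [← hUMV]
    refine NegLE.mul_of_contraction (vnorm_conjTranspose_mulVec_le hUU) ?_
    have hVt : ∀ v, vnorm (Vᵀ *ᵥ v) ≤ vnorm v := by
      have : Vᵀ = (Vᵀᴴ)ᴴ := (conjTranspose_conjTranspose _).symm
      rw [this]
      refine vnorm_conjTranspose_mulVec_le ?_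
      rw [conjTranspose_conjTranspose, show Vᵀᴴ = Vᴴᵀ from rfl, ← transpose_mul, hVV,
        transpose_one, Matrix.mul_one]
    have := (hM.transpose.mul_of_contraction hVt).transpose
    rwa [transpose_mul, transpose_transpose, transpose_transpose] at this

lemma exists_isState_smul {n : ℕ} (hn : 0 < n) (v : Fin n → ℂ) :
    ∃ α : Op n, IsState α ∧ vecMulVec v (star v) = (vnorm v ^ 2) • α := by
  by_cases hv : vnorm v = 0
  · refine ⟨vecMulVec (Pi.single ⟨0, hn⟩ 1) (star (Pi.single ⟨0, hn⟩ 1)),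
      ⟨posSemidef_vecMulVec_self_star _, ?_⟩, ?_⟩
    · rw [trace_vecMulVec]
      simp
    · rw [vnorm_eq_zero hv]
      simp [vnorm]
  · refine ⟨((vnorm v ^ 2)⁻¹ : ℝ) • vecMulVec v (star v),
      ⟨(posSemidef_vecMulVec_self_star _).smul (inv_nonneg.2 (sq_nonneg _)), ?_⟩, ?_⟩
    · rw [trace_smul, trace_vecMulVec, dotProduct_comm, star_dotProduct_self, Complex.real_smul,
        ← Complex.ofReal_mul, inv_mul_cancel₀ (pow_ne_zero 2 hv), Complex.ofReal_one]
    · rw [smul_smul, mul_inv_cancel₀ (pow_ne_zero 2 hv), one_smul]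

lemma exists_separable_smul {a b : ℕ} (ha : 0 < a) (hb : 0 < b) (x : Fin a → ℂ) (g : Fin b → ℂ) :
    ∃ σ ∈ separableStates a b,
      vecMulVec (fun p : Fin a × Fin b => x p.1 * g p.2) (star fun p => x p.1 * g p.2) =
        (vnorm x ^ 2 * vnorm g ^ 2) • σ := by
  obtain ⟨α, hα, hα'⟩ := exists_isState_smul ha x
  obtain ⟨β, hβ, hβ'⟩ := exists_isState_smul hb g
  refine ⟨α ⊗ₖ β, subset_convexHull ℝ _ ⟨α, β, hα, hβ, rfl⟩, ?_⟩
  have : vecMulVec (fun p : Fin a × Fin b => x p.1 * g p.2) (star fun p => x p.1 * g p.2) =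
      vecMulVec x (star x) ⊗ₖ vecMulVec g (star g) := by
    ext p q
    simp only [vecMulVec_apply, kroneckerMap_apply, Pi.star_apply, star_mul']
    ring
  rw [this, hα', hβ', smul_kronecker, kronecker_smul, smul_smul]

lemma IsState.traceNorm_sub_le {ι : Type} [Fintype ι] [DecidableEq ι] {X Y : Matrix ι ι ℂ}
    (hX : IsState X) (hY : IsState Y) : traceNorm (X - Y) ≤ 2 := by
  obtain ⟨m, v, hv⟩ := posSemidef_iff_eq_sum_vecMulVec.1 hX.1
  obtain ⟨m', w, hw⟩ := posSemidef_iff_eq_sum_vecMulVec.1 hY.1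
  have htr : ∀ (m : ℕ) (v : Fin m → ι → ℂ),
      (∑ i, vecMulVec (v i) (star (v i))).trace = ((∑ i, vnorm (v i) ^ 2 : ℝ) : ℂ) := by
    intro m v
    rw [trace_sum, Complex.ofReal_sum]
    refine Finset.sum_congr rfl fun i _ => ?_
    rw [trace_vecMulVec, dotProduct_comm, star_dotProduct_self]
  have h1 := hX.2
  have h2 := hY.2
  rw [hv, htr] at h1
  rw [hw, htr] at h2
  have h := traceNorm_le_of_eq_sum (hX.1.1.sub hY.1.1) (Sum.elim v fun i => (-1 : ℂ) • w i)
    (Sum.elim v w) (by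
      rw [Fintype.sum_sum_type]
      simp only [Sum.elim_inl, Sum.elim_inr, neg_smul, one_smul, neg_vecMulVec,
        Finset.sum_neg_distrib]
      rw [← hv, ← hw, sub_eq_add_neg])
  rw [Fintype.sum_sum_type] at h
  simp only [Sum.elim_inl, Sum.elim_inr, vnorm_smul, norm_neg, norm_one, one_mul, ← sq] at h
  have h1' : ∑ i, vnorm (v i) ^ 2 = 1 := by exact_mod_cast h1
  have h2' : ∑ i, vnorm (w i) ^ 2 = 1 := by exact_mod_cast h2
  rw [h1', h2'] at h
  linarith

lemma EntLE.posSemidef {a b : ℕ} {X : BiOp a b} {r : ℝ} (h : EntLE X r) : X.PosSemidef := by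
  obtain ⟨κ, _, M, e, rfl, -, -⟩ := h
  exact posSemidef_sum _ fun s _ => posSemidef_vecMulVec_self_star _

/-- The total negativity of a decomposition of a state bounds its trace distance to the separable
states. -/
lemma EntLE.exists_separable {a b : ℕ} {X : BiOp a b} {r : ℝ} (h : EntLE X r)
    (hX : X.trace = 1) : ∃ σ ∈ separableStates a b, traceNorm (X - σ) ≤ r ∧
      traceNorm (X - σ) ≤ 2 := by
  have hXs : IsState X := ⟨h.posSemidef, hX⟩
  have hab : 0 < a ∧ 0 < b := by
    by_contra hab
    have : IsEmpty (Fin a × Fin b) := ⟨fun p => hab ⟨p.1.pos, p.2.pos⟩⟩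
    simp [Matrix.trace] at hX
  obtain ⟨κ, _, M, e, rfl, h2, h3⟩ := h
  choose x g hM hg hx hr using fun s => (h2 s).exists_schmidt
  set φ : κ → Fin b → Fin a × Fin b → ℂ := fun s q p => x s q p.1 * g s q p.2
  have hφn : ∀ s q, vnorm (φ s q) = vnorm (x s q) := fun s q => by
    rw [vnorm_tensor, hg, mul_one]
  choose τ hτ hτ' using fun s q => exists_separable_smul hab.1 hab.2 (x s q) (g s q)
  have hw : ∑ s, ∑ q, vnorm (x s q) ^ 2 = 1 := by
    rw [trace_sum] at hX
    simp only [trace_ketbra, ← hx] at hX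
    exact_mod_cast hX
  -- Each pure state is dephased in its own Schmidt basis.
  set σ : BiOp a b := ∑ s, ∑ q, vecMulVec (φ s q) (star (φ s q)) with hσ
  have hσsep : σ ∈ separableStates a b := by
    have : σ = ∑ p : κ × Fin b, (vnorm (x p.1 p.2) ^ 2) • τ p.1 p.2 := by
      rw [Fintype.sum_prod_type]
      refine Finset.sum_congr rfl fun s _ => Finset.sum_congr rfl fun q _ => ?_
      rw [hτ', hg, one_pow, mul_one]
    rw [this]
    refine (convex_convexHull ℝ _).sum_mem (fun p _ => sq_nonneg _) ?_ fun p _ => hτ p.1 p.2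
    rw [Fintype.sum_prod_type]
    exact hw
  refine ⟨σ, hσsep, ?_, hXs.traceNorm_sub_le (isState_of_mem_separableStates hσsep)⟩
  -- Only the terms with q ≠ q' survive; the diagonal is kept in the index set with a zero vector.
  have hdec : ∑ s, ketbra (M s) - σ = ∑ t : κ × Fin b × Fin b,
      vecMulVec (if t.2.1 = t.2.2 then 0 else φ t.1 t.2.1) (star (φ t.1 t.2.2)) := by
    rw [Fintype.sum_prod_type, hσ, ← Finset.sum_sub_distrib]
    refine Finset.sum_congr rfl fun s _ => ?_
    have hψ : ketbra (M s) = ∑ q, ∑ q', vecMulVec (φ s q) (star (φ s q')) := by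
      ext p p'
      simp only [ketbra, Matrix.of_apply, hM, star_sum, Finset.sum_mul_sum, Matrix.sum_apply]
      rfl
    rw [hψ, Fintype.sum_prod_type, ← Finset.sum_sub_distrib]
    refine Finset.sum_congr rfl fun q _ => ?_
    rw [sub_eq_iff_eq_add, ← Finset.sum_erase_add _ _ (Finset.mem_univ q)]
    congr 1
    rw [← Finset.sum_erase_add Finset.univ _ (Finset.mem_univ q)]
    simp only [if_true, zero_vecMulVec, add_zero]
    refine Finset.sum_congr rfl fun q' hq' => ?_
    rw [if_neg (Finset.ne_of_mem_erase hq').symm]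
  refine (traceNorm_le_of_eq_sum
    (hXs.1.1.sub (isState_of_mem_separableStates hσsep).1.1) _ _ hdec).trans ?_
  rw [Fintype.sum_prod_type]
  refine le_trans (Finset.sum_le_sum fun s _ => ?_) h3
  refine le_trans (le_of_eq ?_) (hr s)
  rw [Fintype.sum_prod_type]
  refine Finset.sum_congr rfl fun q _ => Finset.sum_congr rfl fun q' _ => ?_
  dsimp only
  rw [hφn]
  split_ifs
  · simp [vnorm]
  · rw [hφn]

/-! ### The initial bound for arbitrary states -/

/-- Expand `M` along its rows; the factor 1/2 compensates for counting each pair of rows twice. The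
cost is at most (∑‖M_i‖)² - ∑‖M_i‖², and Cauchy–Schwarz gives the factor a - 1. -/
lemma negLE_vnorm_sq {a b : ℕ} (M : Matrix (Fin a) (Fin b) ℂ) :
    NegLE M (((a : ℝ) - 1) * vnorm (fun p : Fin a × Fin b => M p.1 p.2) ^ 2) := by
  refine ⟨Fin a × Fin a, inferInstance, fun t => (1 / 2 : ℂ) • Pi.single t.1 1,
    fun t => Pi.single t.2 1, fun t => M t.1, fun t => M t.2, fun p q => ?_, ?_⟩
  · have h1 : ∀ t : Fin a × Fin a, wedge ((1 / 2 : ℂ) • Pi.single t.1 1) (Pi.single t.2 1) p *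
        wedge (M t.1) (M t.2) q = (if t = p then minor M t q / 2 else 0) -
          (if t = p.swap then minor M t q / 2 else 0) := by
      intro t
      simp only [wedge, minor, Pi.smul_apply, Pi.single_apply, smul_eq_mul, Prod.ext_iff,
        Prod.fst_swap, Prod.snd_swap, @eq_comm _ p.1, @eq_comm _ p.2, ite_and]
      split_ifs <;> ring
    simp only [h1, Finset.sum_sub_distrib, Finset.sum_ite_eq', Finset.mem_univ, if_true]
    simp only [minor, Prod.fst_swap, Prod.snd_swap]
    ring
  · have hs : ∀ i : Fin a, vnorm (Pi.single i (1 : ℂ)) = 1 := by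
      intro i
      rw [← norm_toLp]
      exact (PiLp.norm_single 2 (fun _ => ℂ) i (1 : ℂ)).trans norm_one
    have h1 : ∀ t : Fin a × Fin a,
        vnorm (wedge ((1 / 2 : ℂ) • Pi.single t.1 1) (Pi.single t.2 1)) *
          vnorm (wedge (M t.1) (M t.2)) ≤
        vnorm (M t.1) * vnorm (M t.2) - (if t.1 = t.2 then vnorm (M t.1) ^ 2 else 0) := by
      intro t
      split_ifs with ht
      · have : wedge ((1 / 2 : ℂ) • Pi.single t.1 1) (Pi.single t.2 (1 : ℂ)) = 0 := by
          ext p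
          simp only [wedge, ht, Pi.smul_apply, smul_eq_mul, Pi.zero_apply]
          ring
        rw [this, ht, ← sq, sub_self]
        simp [vnorm]
      · have h2 := vnorm_wedge_le ((1 / 2 : ℂ) • Pi.single t.1 (1 : ℂ)) (Pi.single t.2 1)
        rw [vnorm_smul, hs, hs] at h2
        have h3 := vnorm_wedge_le (M t.1) (M t.2)
        refine (mul_le_mul h2 h3 (vnorm_nonneg _) (by positivity)).trans (le_of_eq ?_)
        have h4 : √2 * √2 = 2 := Real.mul_self_sqrt zero_le_two
        norm_num
        linear_combination (1 / 2 * (vnorm (M t.1) * vnorm (M t.2))) * h4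
    refine (Finset.sum_le_sum fun t _ => h1 t).trans ?_
    have h5 : vnorm (fun p : Fin a × Fin b => M p.1 p.2) ^ 2 = ∑ i, vnorm (M i) ^ 2 := by
      simp only [vnorm_sq, Fintype.sum_prod_type]
    have h6 := sq_sum_le_card_mul_sum_sq (s := Finset.univ) (f := fun i => vnorm (M i))
    rw [Finset.card_univ, Fintype.card_fin, sq, Finset.sum_mul_sum] at h6
    rw [Finset.sum_sub_distrib, Fintype.sum_prod_type, Fintype.sum_prod_type, h5]
    simp only [Finset.sum_ite_eq, Finset.mem_univ, if_true]
    linarith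

lemma IsState.entLE {a b : ℕ} {ρ : BiOp a b} (hρ : IsState ρ) : EntLE ρ ((a : ℝ) - 1) := by
  obtain ⟨m, v, rfl⟩ := posSemidef_iff_eq_sum_vecMulVec.1 hρ.1
  refine ⟨Fin m, inferInstance, fun s => Matrix.of fun i k => v s (i, k), _, rfl,
    fun s => negLE_vnorm_sq _, le_of_eq ?_⟩
  rw [← Finset.mul_sum]
  have h := hρ.2
  rw [trace_sum] at h
  simp only [trace_vecMulVec, dotProduct_comm _ (star _), star_dotProduct_self] at h
  have h' : ∑ s, vnorm (v s) ^ 2 = 1 := by exact_mod_cast h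
  exact (congrArg _ h').trans (mul_one _)

/-! ### Error correction: the Knill–Laflamme conditions suffice -/

lemma IsKraus.isCP {a a' : ℕ} {κ : Type} [Fintype κ] {E : Op a →ₗ[ℂ] Op a'}
    {K : κ → Matrix (Fin a') (Fin a) ℂ} (hK : IsKraus E K) : IsCP E := by
  intro r X hX
  obtain ⟨m, v, rfl⟩ := posSemidef_iff_eq_sum_vecMulVec.1 hX
  rw [map_sum]
  refine posSemidef_sum _ fun i _ => ?_
  have : vecMulVec (v i) (star (v i)) = ketbra (Matrix.of fun j k => v i (j, k)) := rfl
  rw [this, hK.onA_ketbra]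
  exact posSemidef_sum _ fun s _ => posSemidef_vecMulVec_self_star _

/-- The completely positive map with given Kraus operators. -/
def krausMap {a a' : ℕ} {κ : Type} [Fintype κ] (K : κ → Matrix (Fin a') (Fin a) ℂ) :
    Op a →ₗ[ℂ] Op a' where
  toFun X := ∑ s, K s * X * (K s)ᴴ
  map_add' X Y := by simp only [Matrix.mul_add, Matrix.add_mul, Finset.sum_add_distrib]
  map_smul' c X := by simp [Finset.smul_sum]

lemma isKraus_krausMap {a a' : ℕ} {κ : Type} [Fintype κ] (K : κ → Matrix (Fin a') (Fin a) ℂ) :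
    IsKraus (krausMap K) K := fun _ => rfl

lemma isChannel_krausMap {a a' : ℕ} {κ : Type} [Fintype κ] (K : κ → Matrix (Fin a') (Fin a) ℂ)
    (hK : ∑ s, (K s)ᴴ * K s = 1) : IsChannel (krausMap K) := by
  refine ⟨(isKraus_krausMap K).isCP, fun X => ?_⟩
  rw [isKraus_krausMap K, trace_sum]
  simp only [trace_mul_comm _ (K _)ᴴ, ← Matrix.mul_assoc]
  rw [← trace_sum, ← Finset.sum_mul, hK, Matrix.one_mul]

lemma mul_pureState_mul {a a' : ℕ} (K : Matrix (Fin a') (Fin a) ℂ) (ψ : Fin a → ℂ) :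
    K * pureState ψ * Kᴴ = pureState (K *ᵥ ψ) := by
  rw [pureState, mul_vecMulVec, vecMulVec_mul, ← star_mulVec]
  rfl

lemma trace_pureState {a : ℕ} (ψ : Fin a → ℂ) : (pureState ψ).trace = ((vnorm ψ ^ 2 : ℝ) : ℂ) := by
  rw [pureState, trace_vecMulVec, dotProduct_comm, star_dotProduct_self]

lemma pureState_smul {a : ℕ} (c : ℂ) (ψ : Fin a → ℂ) :
    pureState (c • ψ) = (c * star c) • pureState ψ := by
  rw [pureState, star_smul, smul_vecMulVec, vecMulVec_smul, smul_smul]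
  rfl

/-- Kraus operators that are orthogonal on the range of the isometry `B` can be undone there. -/
lemma isCorrectable_of_orthogonal {d N : ℕ} {Λ : Op d →ₗ[ℂ] Op d} (hΛ : IsChannel Λ)
    {L : Fin N → Matrix (Fin d) (Fin d) ℂ} (hL : IsKraus Λ L) {B : Matrix (Fin d) (Fin 2) ℂ}
    (hB : Bᴴ * B = 1) (n : Fin N → ℝ)
    (h : ∀ s t, (L s * B)ᴴ * (L t * B) = if s = t then ((n s ^ 2 : ℝ) : ℂ) • 1 else 0) :
    IsCorrectable Λ (LinearMap.range B.mulVecLin) := by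
  have hinj : Function.Injective B.mulVecLin := by
    intro x y hxy
    have := congrArg (fun z => Bᴴ *ᵥ z) hxy
    simpa [mulVec_mulVec, hB] using this
  refine ⟨?_, ?_⟩
  · rw [LinearMap.finrank_range_of_inj hinj]
    simp
  -- Isometries onto mutually orthogonal ranges, or zero when `n s = 0` because 0⁻¹ = 0.
  set W : Fin N → Matrix (Fin d) (Fin 2) ℂ := fun s => (((n s)⁻¹ : ℝ) : ℂ) • (L s * B) with hW
  have hLW : ∀ s, L s * B = (n s : ℂ) • W s := by
    intro s
    by_cases hs : n s = 0
    · have h1 := h s s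
      rw [if_pos rfl, hs] at h1
      simp only [ne_eq, OfNat.ofNat_ne_zero, not_false_eq_true, zero_pow, Complex.ofReal_zero,
        zero_smul] at h1
      rw [conjTranspose_mul_self_eq_zero.1 h1, hs, Complex.ofReal_zero, zero_smul]
    · rw [hW, smul_smul, ← Complex.ofReal_mul, mul_inv_cancel₀ hs, Complex.ofReal_one, one_smul]
  have hWW : ∀ s t, W s * ((W s)ᴴ * W t) = if s = t then W t else 0 := by
    intro s t
    have h1 : (W s)ᴴ * W t = ((((n s)⁻¹ : ℝ) : ℂ) * (((n t)⁻¹ : ℝ) : ℂ)) •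
        ((L s * B)ᴴ * (L t * B)) := by
      rw [hW, conjTranspose_smul, Matrix.smul_mul, Matrix.mul_smul, smul_smul, Complex.star_def,
        Complex.conj_ofReal]
    rw [h1, h]
    by_cases hst : s = t
    · subst hst
      rw [if_pos rfl, if_pos rfl, smul_smul, Matrix.mul_smul, Matrix.mul_one, hW]
      dsimp only
      rw [smul_smul]
      congr 1
      by_cases hs : n s = 0
      · simp [hs]
      · norm_cast
        field_simp
    · rw [if_neg hst, if_neg hst, smul_zero, Matrix.mul_zero]
  set Q : Matrix (Fin d) (Fin d) ℂ := ∑ s, W s * (W s)ᴴ with hQ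
  have hQW : ∀ t, Q * W t = W t := by
    intro t
    rw [hQ, Matrix.sum_mul]
    simp only [Matrix.mul_assoc, hWW]
    simp
  have hQh : Qᴴ = Q := by
    rw [hQ, conjTranspose_sum]
    simp [conjTranspose_mul]
  have hQQ : Q * Q = Q := by
    conv_lhs => rw [hQ, Finset.mul_sum]
    simp only [← Matrix.mul_assoc, hQ.symm, hQW]
  -- Recovery detects the range that occurred and maps it back to the code; `1 - Q` is the
  -- projection onto the unused complement and only completes the channel.
  set R : Option (Fin N) → Matrix (Fin d) (Fin d) ℂ := fun o => o.elim (1 - Q) fun s => B * (W s)ᴴ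
  have hR : IsChannel (krausMap R) := by
    refine isChannel_krausMap R ?_
    rw [Fintype.sum_option]
    have h1 : (R none)ᴴ * R none = 1 - Q := by
      change (1 - Q)ᴴ * (1 - Q) = 1 - Q
      rw [conjTranspose_sub, conjTranspose_one, hQh, Matrix.mul_sub, Matrix.mul_one, Matrix.sub_mul,
        Matrix.one_mul, hQQ, sub_self, sub_zero]
    have h2 : ∀ s, (R (some s))ᴴ * R (some s) = W s * (W s)ᴴ := by
      intro s
      change (B * (W s)ᴴ)ᴴ * (B * (W s)ᴴ) = _
      rw [conjTranspose_mul, conjTranspose_conjTranspose, Matrix.mul_assoc, ← Matrix.mul_assoc Bᴴ,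
        hB, Matrix.one_mul]
    simp only [h1, h2]
    rw [← hQ, sub_add_cancel]
  have hWWB : ∀ s t, ∃ e : ℂ, (W s)ᴴ * (L t * B) = e • 1 := by
    intro s t
    rw [hW, conjTranspose_smul, Matrix.smul_mul, h]
    split_ifs
    · exact ⟨_, smul_smul _ _ _⟩
    · exact ⟨0, by simp⟩
  choose e he using hWWB
  have hact : ∀ c, krausMap R (Λ (pureState (B *ᵥ c))) =
      (∑ s, ∑ t, e s t * star (e s t)) • pureState (B *ᵥ c) := by
    intro c
    rw [isKraus_krausMap R, Fintype.sum_option, hL]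
    have h1 : R none * (∑ t, L t * pureState (B *ᵥ c) * (L t)ᴴ) * (R none)ᴴ = 0 := by
      rw [Finset.mul_sum, Finset.sum_mul]
      refine Finset.sum_eq_zero fun t _ => ?_
      rw [mul_pureState_mul, mul_pureState_mul, mulVec_mulVec c (L t) B, hLW, mulVec_mulVec]
      have : R none * ((n t : ℂ) • W t) = 0 := by
        change (1 - Q) * ((n t : ℂ) • W t) = 0
        rw [Matrix.mul_smul, Matrix.sub_mul, Matrix.one_mul, hQW, sub_self, smul_zero]
      rw [this, zero_mulVec]
      simp [pureState]
    rw [h1, zero_add, Finset.sum_smul]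
    refine Finset.sum_congr rfl fun s _ => ?_
    rw [Finset.mul_sum, Finset.sum_mul, Finset.sum_smul]
    refine Finset.sum_congr rfl fun t _ => ?_
    rw [mul_pureState_mul, mul_pureState_mul, mulVec_mulVec c (L t) B, mulVec_mulVec]
    have : R (some s) * (L t * B) = e s t • B := by
      change B * (W s)ᴴ * _ = _
      rw [Matrix.mul_assoc, he, Matrix.mul_smul, Matrix.mul_one]
    rw [this, smul_mulVec, pureState_smul]
  refine ⟨krausMap R, hR, ?_⟩
  rintro _ ⟨c, rfl⟩
  rw [mulVecLin_apply]
  by_cases hc : vnorm (B *ᵥ c) = 0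
  · rw [vnorm_eq_zero hc]
    simp [pureState]
  -- The proportionality factor need not be computed: trace preservation forces it to be 1.
  · have htr := congrArg Matrix.trace (hact c)
    rw [hR.2, hΛ.2, trace_smul, trace_pureState, smul_eq_mul] at htr
    have hne : ((vnorm (B *ᵥ c) ^ 2 : ℝ) : ℂ) ≠ 0 := by exact_mod_cast pow_ne_zero 2 hc
    rw [hact, ← mul_right_cancel₀ hne ((one_mul _).trans htr), one_smul]

/-- **Knill–Laflamme condition**, for two-dimensional codes. -/
lemma isCorrectable_of_knillLaflamme {d N : ℕ} {Λ : Op d →ₗ[ℂ] Op d} (hΛ : IsChannel Λ)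
    {K : Fin N → Matrix (Fin d) (Fin d) ℂ} (hK : IsKraus Λ K) {B : Matrix (Fin d) (Fin 2) ℂ}
    (hB : Bᴴ * B = 1) {α : Matrix (Fin N) (Fin N) ℂ}
    (h : ∀ i j, (K i * B)ᴴ * (K j * B) = α i j • 1) :
    IsCorrectable Λ (LinearMap.range B.mulVecLin) := by
  have hα : α.IsHermitian := by
    ext i j
    have h1 := congrArg (fun Z => Zᴴ 0 0) (h j i)
    rw [conjTranspose_apply]
    simp only [conjTranspose_mul, conjTranspose_conjTranspose, conjTranspose_smul,
      conjTranspose_one, Matrix.smul_apply, one_apply_eq, smul_eq_mul, mul_one] at h1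
    rw [← h1]
    have h2 := congrArg (fun Z => Z 0 0) (h i j)
    simp only [conjTranspose_mul, Matrix.smul_apply, one_apply_eq, smul_eq_mul, mul_one] at h2
    rw [h2]
  set W : Matrix (Fin N) (Fin N) ℂ := hα.eigenvectorUnitary.1
  have hWW : Wᴴ * W = 1 := Unitary.coe_star_mul_self _
  have hWW' : W * Wᴴ = 1 := Unitary.coe_mul_star_self _
  obtain ⟨p, hspec⟩ : ∃ p : Fin N → ℝ, α = W * diagonal (fun i => (p i : ℂ)) * Wᴴ := by
    refine ⟨hα.eigenvalues, ?_⟩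
    conv_lhs => rw [hα.spectral_theorem, Unitary.conjStarAlgAut_apply]
    rfl
  have hdiag : Wᴴ * α * W = diagonal (fun i => (p i : ℂ)) := by
    rw [hspec]
    simp only [Matrix.mul_assoc, hWW, Matrix.mul_one]
    rw [← Matrix.mul_assoc, hWW, Matrix.one_mul]
  -- Unitary mixing gives another Kraus family of `Λ`; the unitary diagonalizing `α` makes the error
  -- spaces orthogonal.
  set L : Fin N → Matrix (Fin d) (Fin d) ℂ := fun s => ∑ i, W i s • K i with hL
  have hLK : IsKraus Λ L := by
    intro X
    have hcoef : ∀ i j, ∑ s, W i s * star (W j s) = if i = j then 1 else 0 := by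
      intro i j
      have := congrFun (congrFun hWW' i) j
      rw [Matrix.mul_apply, Matrix.one_apply] at this
      exact this
    have h1 : ∀ s, L s * X * (L s)ᴴ = ∑ i, ∑ j, (W i s * star (W j s)) • (K i * X * (K j)ᴴ) := by
      intro s
      simp only [hL, conjTranspose_sum, Finset.sum_mul, Finset.mul_sum, conjTranspose_smul,
        Matrix.smul_mul, Matrix.mul_smul, smul_smul]
      rw [Finset.sum_comm]
      exact Finset.sum_congr rfl fun i _ => Finset.sum_congr rfl fun j _ => by rw [mul_comm]
    simp only [h1]
    rw [Finset.sum_comm]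
    simp only [Finset.sum_comm (s := Finset.univ (α := Fin N)) (t := Finset.univ (α := Fin N))
      (f := fun s j => (W _ s * star (W j s)) • (K _ * X * (K j)ᴴ))]
    simp only [← Finset.sum_smul, hcoef, ite_smul, one_smul, zero_smul, Finset.sum_ite_eq,
      Finset.mem_univ, if_true]
    exact hK X
  have hLL : ∀ s t, (L s * B)ᴴ * (L t * B) = if s = t then (p s : ℂ) • 1 else 0 := by
    intro s t
    have h1 : (L s * B)ᴴ * (L t * B) = ∑ i, ∑ j, (star (W i s) * W j t) •
        ((K i * B)ᴴ * (K j * B)) := by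
      simp only [hL, Matrix.sum_mul, Matrix.mul_sum, conjTranspose_sum, conjTranspose_smul,
        Matrix.smul_mul, Matrix.mul_smul, Finset.smul_sum, smul_smul]
      rw [Finset.sum_comm]
      exact Finset.sum_congr rfl fun i _ => Finset.sum_congr rfl fun j _ => by rw [mul_comm]
    have h2 := congrFun (congrFun hdiag s) t
    rw [Matrix.mul_assoc, Matrix.mul_apply] at h2
    simp only [Matrix.mul_apply, Finset.mul_sum, conjTranspose_apply, diagonal_apply] at h2
    rw [h1]
    simp only [h, smul_smul, ← Finset.sum_smul]
    have h3 : ∑ i, ∑ j, star (W i s) * W j t * α i j = if s = t then (p s : ℂ) else 0 := by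
      rw [← h2]
      exact Finset.sum_congr rfl fun i _ => Finset.sum_congr rfl fun j _ => by ring
    rw [h3]
    split_ifs <;> simp
  have hp : ∀ s, 0 ≤ p s := by
    intro s
    have h1 := (posSemidef_conjTranspose_mul_self (L s * B)).diag_nonneg (i := 0)
    rw [hLL, if_pos rfl, Matrix.smul_apply, one_apply_eq, smul_eq_mul, mul_one] at h1
    exact_mod_cast h1
  refine isCorrectable_of_orthogonal hΛ hLK hB (fun s => √(p s)) fun s t => ?_
  rw [hLL, Real.sq_sqrt (hp s)]

/-! ### Strict contraction without a correctable subspace -/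

lemma IsKraus.sum_vnorm_sq {a a' : ℕ} {κ : Type} [Fintype κ] {E : Op a →ₗ[ℂ] Op a'}
    {K : κ → Matrix (Fin a') (Fin a) ℂ} (hK : IsKraus E K) (hE : IsChannel E) (v : Fin a → ℂ) :
    ∑ s, vnorm (K s *ᵥ v) ^ 2 = vnorm v ^ 2 := by
  have h := hE.2 (pureState v)
  rw [hK, trace_sum] at h
  simp only [mul_pureState_mul, trace_pureState] at h
  exact_mod_cast h

/-- The fourth roots of unity. -/
def quarter : Fin 4 → ℂ := ![1, Complex.I, -1, -Complex.I]

lemma eq_zero_of_polarization {N : ℕ} {β : Fin N → Fin N → ℂ}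
    (h : ∀ i j t, β i i + quarter t * β i j + star (quarter t) * β j i + β j j = 0) (i j : Fin N) :
    β i j = 0 := by
  have h0 := h i j 0
  have h1 := h i j 1
  have h2 := h i j 2
  have h3 := h i j 3
  simp [quarter] at h0 h1 h2 h3
  have hI : Complex.I * Complex.I = -1 := Complex.I_mul_I
  linear_combination (h0 - h2) / 4 - Complex.I * (h1 - h3) / 4 + (1 / 2) * (β i j - β j i) * hI

/-- A Kraus family rich enough to polarize the quadratic conditions `⟨K u, K v⟩ = 0` and
`⟨K u, K u⟩ = ⟨K v, K v⟩`. -/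
def mixedKraus {d N : ℕ} (K : Fin N → Matrix (Fin d) (Fin d) ℂ) (s : Fin N × Fin N × Fin 4) :
    Matrix (Fin d) (Fin d) ℂ :=
  (((√(8 * N))⁻¹ : ℝ) : ℂ) • (K s.1 + quarter s.2.2 • K s.2.1)

/-- The cross terms cancel because the fourth roots of unity sum to zero. Each `K i` then occurs 4 ·
2 · N times, which explains the normalization 8N. -/
lemma isKraus_mixedKraus {d N : ℕ} {Λ : Op d →ₗ[ℂ] Op d}
    {K : Fin N → Matrix (Fin d) (Fin d) ℂ} (hK : IsKraus Λ K) : IsKraus Λ (mixedKraus K) := by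
  intro X
  rcases Nat.eq_zero_or_pos N with rfl | hN
  · rw [hK]
    simp
  set c : ℂ := (((√(8 * N))⁻¹ : ℝ) : ℂ) with hc
  have hcc : c * star c * (8 * N) = 1 := by
    rw [hc, Complex.star_def, Complex.conj_ofReal, ← Complex.ofReal_mul, ← mul_inv,
      Real.mul_self_sqrt (by positivity)]
    push_cast
    have : (N : ℂ) ≠ 0 := by exact_mod_cast hN.ne'
    field_simp
  have h1 : ∀ i j, ∑ t, mixedKraus K (i, j, t) * X * (mixedKraus K (i, j, t))ᴴ =
      (c * star c * 4) • (K i * X * (K i)ᴴ + K j * X * (K j)ᴴ) := by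
    intro i j
    have h2 : ∀ t, mixedKraus K (i, j, t) * X * (mixedKraus K (i, j, t))ᴴ = (c * star c) •
        (K i * X * (K i)ᴴ + (quarter t * star (quarter t)) • (K j * X * (K j)ᴴ) +
          quarter t • (K j * X * (K i)ᴴ) + star (quarter t) • (K i * X * (K j)ᴴ)) := by
      intro t
      simp only [mixedKraus, conjTranspose_smul, conjTranspose_add, Matrix.smul_mul, Matrix.mul_smul,
        Matrix.add_mul, Matrix.mul_add, smul_smul, smul_add, ← hc]
      ext p q
      simp only [Matrix.add_apply, Matrix.smul_apply, smul_eq_mul, star_mul']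
      ring
    simp only [h2, Fin.sum_univ_four, quarter]
    ext p q
    simp
    ring
  rw [Fintype.sum_prod_type]
  simp only [Fintype.sum_prod_type, h1, ← Finset.smul_sum, Finset.sum_add_distrib, Finset.sum_const,
    Finset.card_univ, Fintype.card_fin, ← hK X]
  rw [← two_nsmul, ← Nat.cast_smul_eq_nsmul ℂ, ← Nat.cast_smul_eq_nsmul ℂ, smul_smul, smul_smul,
    show c * star c * 4 * (2 : ℕ) * (N : ℂ) = 1 by push_cast; linear_combination hcc, one_smul]

lemma vnorm_wedge_le_add_sq {n : ℕ} (x y : Fin n → ℂ) :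
    vnorm (wedge x y) ≤ √2 * ((vnorm x ^ 2 + vnorm y ^ 2) / 2) ∧
    (vnorm (wedge x y) = √2 * ((vnorm x ^ 2 + vnorm y ^ 2) / 2) →
      vnorm x = vnorm y ∧ star x ⬝ᵥ y = 0) := by
  refine ⟨(vnorm_wedge_le _ _).trans (mul_le_mul_of_nonneg_left
    (by nlinarith [sq_nonneg (vnorm x - vnorm y)]) (Real.sqrt_nonneg 2)), fun h => ?_⟩
  have h1 := vnorm_wedge_sq x y
  rw [h, mul_pow, Real.sq_sqrt zero_le_two] at h1
  have h2 : (vnorm x ^ 2 - vnorm y ^ 2) ^ 2 + 4 * ‖star x ⬝ᵥ y‖ ^ 2 = 0 := by linarith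
  have h3 : vnorm x ^ 2 = vnorm y ^ 2 := by
    nlinarith [sq_nonneg (vnorm x ^ 2 - vnorm y ^ 2), sq_nonneg ‖star x ⬝ᵥ y‖]
  have h4 : ‖star x ⬝ᵥ y‖ = 0 := by
    nlinarith [sq_nonneg (vnorm x ^ 2 - vnorm y ^ 2), sq_nonneg ‖star x ⬝ᵥ y‖]
  exact ⟨(sq_eq_sq₀ (vnorm_nonneg _) (vnorm_nonneg _)).1 h3, norm_eq_zero.1 h4⟩

/-- Equality would make every mixed operator send `u`, `v` to orthogonal vectors of equal length.
Polarization over the fourth roots turns this into ⟨K_i u, K_j v⟩ = 0 and ⟨K_i u, K_j u⟩ = ⟨K_i v,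
K_j v⟩ for all i, j, the Knill–Laflamme conditions on the span. -/
lemma sum_vnorm_wedge_lt {d N : ℕ} {Λ : Op d →ₗ[ℂ] Op d} (hΛ : IsChannel Λ)
    (hno : ¬ ∃ H : Submodule ℂ (Fin d → ℂ), IsCorrectable Λ H)
    {K : Fin N → Matrix (Fin d) (Fin d) ℂ} (hK : IsKraus Λ K) {u v : Fin d → ℂ}
    (hu : vnorm u = 1) (hv : vnorm v = 1) (huv : star u ⬝ᵥ v = 0) :
    ∑ s, vnorm (wedge (mixedKraus K s *ᵥ u) (mixedKraus K s *ᵥ v)) < √2 := by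
  set L := mixedKraus K with hL
  have hLK : IsKraus Λ L := isKraus_mixedKraus hK
  have hsum : ∑ s, √2 * ((vnorm (L s *ᵥ u) ^ 2 + vnorm (L s *ᵥ v) ^ 2) / 2) = √2 := by
    rw [← Finset.mul_sum, ← Finset.sum_div, Finset.sum_add_distrib, hLK.sum_vnorm_sq hΛ,
      hLK.sum_vnorm_sq hΛ, hu, hv]
    norm_num
  have hle := Finset.sum_le_sum fun s (_ : s ∈ Finset.univ) =>
    (vnorm_wedge_le_add_sq (L s *ᵥ u) (L s *ᵥ v)).1
  rw [hsum] at hle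
  refine lt_of_le_of_ne hle fun heq => hno ?_
  have hterm := (Finset.sum_eq_sum_iff_of_le fun s (_ : s ∈ Finset.univ) =>
    (vnorm_wedge_le_add_sq (L s *ᵥ u) (L s *ᵥ v)).1).1 (heq.trans hsum.symm)
  have hN : 0 < N := by
    by_contra hN
    obtain rfl : N = 0 := by omega
    have := hK.sum_vnorm_sq hΛ u
    rw [hu] at this
    simp at this
  set c : ℂ := (((√(8 * N))⁻¹ : ℝ) : ℂ) with hc
  have hc0 : c * star c ≠ 0 := by
    rw [hc, Complex.star_def, Complex.conj_ofReal]
    have : √(8 * (N : ℝ)) ≠ 0 := by positivity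
    norm_cast
    positivity
  have hexp : ∀ x y : Fin d → ℂ, ∀ i j t, star (L (i, j, t) *ᵥ x) ⬝ᵥ (L (i, j, t) *ᵥ y) =
      c * star c * (star (K i *ᵥ x) ⬝ᵥ (K i *ᵥ y) + quarter t * (star (K i *ᵥ x) ⬝ᵥ (K j *ᵥ y)) +
        star (quarter t) * (star (K j *ᵥ x) ⬝ᵥ (K i *ᵥ y)) +
          quarter t * star (quarter t) * (star (K j *ᵥ x) ⬝ᵥ (K j *ᵥ y))) := by
    intro x y i j t
    simp only [hL, mixedKraus, smul_mulVec, add_mulVec, star_smul, star_add, smul_dotProduct,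
      dotProduct_smul, add_dotProduct, dotProduct_add, smul_eq_mul, ← hc]
    ring
  have hqq : ∀ t, quarter t * star (quarter t) = 1 := by
    intro t
    fin_cases t <;> simp [quarter]
  have hcross : ∀ i j, star (K i *ᵥ u) ⬝ᵥ (K j *ᵥ v) = 0 := by
    refine eq_zero_of_polarization (β := fun i j => star (K i *ᵥ u) ⬝ᵥ (K j *ᵥ v)) fun i j t => ?_
    have h1 := ((vnorm_wedge_le_add_sq _ _).2 (hterm (i, j, t) (Finset.mem_univ _))).2
    rw [hexp, hqq, one_mul] at h1
    exact (mul_eq_zero.1 h1).resolve_left hc0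
  have hsame : ∀ i j, star (K i *ᵥ u) ⬝ᵥ (K j *ᵥ u) = star (K i *ᵥ v) ⬝ᵥ (K j *ᵥ v) := by
    intro i j
    refine sub_eq_zero.1 (eq_zero_of_polarization (β := fun i j =>
      star (K i *ᵥ u) ⬝ᵥ (K j *ᵥ u) - star (K i *ᵥ v) ⬝ᵥ (K j *ᵥ v)) (fun i j t => ?_) i j)
    have h1 := ((vnorm_wedge_le_add_sq _ _).2 (hterm (i, j, t) (Finset.mem_univ _))).1
    have h2 : star (L (i, j, t) *ᵥ u) ⬝ᵥ (L (i, j, t) *ᵥ u) =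
        star (L (i, j, t) *ᵥ v) ⬝ᵥ (L (i, j, t) *ᵥ v) := by
      rw [star_dotProduct_self, star_dotProduct_self, h1]
    rw [hexp, hexp, hqq, one_mul, one_mul] at h2
    linear_combination mul_left_cancel₀ hc0 h2
  have hentry : ∀ (x y : Fin d → ℂ), star x ⬝ᵥ y = 0 → star y ⬝ᵥ x = 0 := by
    intro x y hxy
    rw [star_dotProduct, hxy, star_zero]
  set B : Matrix (Fin d) (Fin 2) ℂ := Matrix.of fun i k => (![u, v] k) i with hB
  have hBB : ∀ (P P' : Matrix (Fin d) (Fin d) ℂ) k l, ((P * B)ᴴ * (P' * B)) k l =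
      star (P *ᵥ (![u, v] k)) ⬝ᵥ (P' *ᵥ (![u, v] l)) := fun P P' k l => rfl
  refine ⟨_, isCorrectable_of_knillLaflamme hΛ hK (B := B)
    (α := Matrix.of fun i j => star (K i *ᵥ u) ⬝ᵥ (K j *ᵥ u)) ?_ fun i j => ?_⟩
  · ext k l
    rw [← Matrix.one_mul B, hBB, one_mulVec, one_mulVec]
    fin_cases k <;> fin_cases l <;> simp [star_dotProduct_self, hu, hv, huv, hentry u v huv]
  · ext k l
    rw [hBB]
    fin_cases k <;> fin_cases l <;>
      simp [hcross, hsame, hentry _ _ (hcross _ _)]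

lemma continuous_vnorm {ι : Type} [Fintype ι] : Continuous (vnorm : (ι → ℂ) → ℝ) := by
  unfold vnorm
  fun_prop

/-- A channel without correctable subspace has Kraus operators that strictly shrink all `x ∧ y`. -/
lemma exists_wedgeContracts {d : ℕ} {Λ : Op d →ₗ[ℂ] Op d} (hΛ : IsChannel Λ)
    (hno : ¬ ∃ H : Submodule ℂ (Fin d → ℂ), IsCorrectable Λ H) :
    ∃ (κ : Type) (_ : Fintype κ) (L : κ → Matrix (Fin d) (Fin d) ℂ) (c : ℝ),
      IsKraus Λ L ∧ 0 < c ∧ c < 1 ∧ WedgeContracts L c := by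
  obtain ⟨N, K, hK⟩ := hΛ.1.exists_isKraus
  set S : Set ((Fin d → ℂ) × (Fin d → ℂ)) :=
    {p | vnorm p.1 = 1 ∧ vnorm p.2 = 1 ∧ star p.1 ⬝ᵥ p.2 = 0}
  set f : (Fin d → ℂ) × (Fin d → ℂ) → ℝ := fun p =>
    ∑ s, vnorm (wedge (mixedKraus K s *ᵥ p.1) (mixedKraus K s *ᵥ p.2)) with hf
  have hball : ∀ u : Fin d → ℂ, vnorm u = 1 → u ∈ Metric.closedBall (0 : Fin d → ℂ) 1 := by
    intro u hu
    rw [mem_closedBall_zero_iff, pi_norm_le_iff_of_nonneg zero_le_one]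
    intro i
    refine abs_le_of_sq_le_sq' ?_ zero_le_one |>.2
    rw [one_pow, ← one_pow 2, ← hu, vnorm_sq]
    exact Finset.single_le_sum (f := fun l => ‖u l‖ ^ 2) (fun _ _ => sq_nonneg _)
      (Finset.mem_univ i)
  have hS : IsCompact S := by
    refine ((isCompact_closedBall (0 : Fin d → ℂ) 1).prod
      (isCompact_closedBall (0 : Fin d → ℂ) 1)).of_isClosed_subset ?_ ?_
    · refine (isClosed_eq (continuous_vnorm.comp continuous_fst) continuous_const).inter
        ((isClosed_eq (continuous_vnorm.comp continuous_snd) continuous_const).inter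
          (isClosed_eq (Continuous.dotProduct ?_ continuous_snd) continuous_const))
      exact continuous_star.comp continuous_fst
    · rintro ⟨u, v⟩ ⟨hu, hv, -⟩
      exact ⟨hball u hu, hball v hv⟩
  have hfc : Continuous f := by
    refine continuous_finsetSum _ fun s _ => continuous_vnorm.comp ?_
    have h1 : Continuous fun p : (Fin d → ℂ) × (Fin d → ℂ) => mixedKraus K s *ᵥ p.1 :=
      continuous_const.matrix_mulVec continuous_fst
    have h2 : Continuous fun p : (Fin d → ℂ) × (Fin d → ℂ) => mixedKraus K s *ᵥ p.2 :=
      continuous_const.matrix_mulVec continuous_snd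
    refine continuous_pi fun q => ?_
    exact (((continuous_apply q.1).comp h1).mul ((continuous_apply q.2).comp h2)).sub
      (((continuous_apply q.2).comp h1).mul ((continuous_apply q.1).comp h2))
  have h2 : (0 : ℝ) < √2 := by positivity
  -- The maximum over the compact set of orthonormal pairs is below √2. Taking the maximum with 1/2
  -- keeps `c` positive, as the real powers later require.
  obtain ⟨c, hc0, hc1, hc⟩ : ∃ c : ℝ, 0 < c ∧ c < 1 ∧ ∀ p ∈ S, f p ≤ c * √2 := by
    rcases S.eq_empty_or_nonempty with hSe | hSne
    · exact ⟨1 / 2, by norm_num, by norm_num, by simp [hSe]⟩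
    · obtain ⟨p, hp, hmax⟩ := hS.exists_isMaxOn hSne hfc.continuousOn
      have hlt : f p < √2 := sum_vnorm_wedge_lt hΛ hno hK hp.1 hp.2.1 hp.2.2
      refine ⟨max (f p / √2) (1 / 2), by positivity, max_lt ((div_lt_one h2).2 hlt) (by norm_num),
        fun q hq => ?_⟩
      rw [← div_le_iff₀ h2]
      exact le_max_of_le_left (div_le_div_of_nonneg_right (hmax hq) h2.le)
  exact ⟨_, inferInstance, mixedKraus K, c, isKraus_mixedKraus hK, hc0, hc1,
    wedgeContracts_of_orthonormal _ hc0.le fun u v hu hv huv => hc (u, v) ⟨hu, hv, huv⟩⟩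

/-! ### Iteration, the numerical estimate and limits of protocols -/

lemma entLE_chainFrom {a b m : ℕ} {κ : Type} [Fintype κ] {Λ : Op a →ₗ[ℂ] Op a}
    {L : κ → Matrix (Fin a) (Fin a) ℂ} (hL : IsKraus Λ L) {c : ℝ} (hc : 0 ≤ c)
    (hW : WedgeContracts L c) {F : List (Fin m) → Fin m → BiOp a b →ₗ[ℂ] BiOp a b}
    (hF : ∀ h, IsFiniteLOCC (F h)) (n : ℕ) (h : List (Fin m)) {X : BiOp a b} {r : ℝ}
    (hX : EntLE X r) : EntLE (chainFrom Λ F n h X) (c ^ n * r) := by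
  induction n generalizing h X r with
  | zero => simpa [chainFrom] using hX
  | succ n ih =>
    obtain ⟨e, he, hs⟩ := (hF h).entLE hX
    simp only [chainFrom, LinearMap.sum_apply, LinearMap.comp_apply]
    refine (EntLE.sum fun j => ih (h ++ [j]) (hL.entLE_onA hc hW (he j))).mono ?_
    rw [← Finset.mul_sum, ← Finset.mul_sum, ← mul_assoc, ← pow_succ]
    exact mul_le_mul_of_nonneg_left hs (pow_nonneg hc _)

lemma trace_chainFrom {a b m : ℕ} {Λ : Op a →ₗ[ℂ] Op a} (hΛ : IsChannel Λ)
    {F : List (Fin m) → Fin m → BiOp a b →ₗ[ℂ] BiOp a b}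
    (hF : ∀ h, IsFiniteLOCC (F h)) (n : ℕ) (h : List (Fin m)) (X : BiOp a b) :
    (chainFrom Λ F n h X).trace = X.trace := by
  induction n generalizing h X with
  | zero => simp [chainFrom]
  | succ n ih =>
    simp only [chainFrom, LinearMap.sum_apply, LinearMap.comp_apply, trace_sum, ih, hΛ.trace_onA]
    exact (hF h).sum_trace X

/-- Pointwise limits of linear maps on matrices are compatible with limits of arguments. -/
lemma tendsto_linearMap_apply {ι ι' : Type} [Fintype ι] [DecidableEq ι]
    {A : ℕ → Matrix ι ι ℂ →ₗ[ℂ] Matrix ι' ι' ℂ} {A₀ : Matrix ι ι ℂ →ₗ[ℂ] Matrix ι' ι' ℂ}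
    (hA : ∀ X, Filter.Tendsto (fun t => A t X) Filter.atTop (nhds (A₀ X)))
    {Y : ℕ → Matrix ι ι ℂ} {Y₀ : Matrix ι ι ℂ} (hY : Filter.Tendsto Y Filter.atTop (nhds Y₀)) :
    Filter.Tendsto (fun t => A t (Y t)) Filter.atTop (nhds (A₀ Y₀)) := by
  have hexp : ∀ (B : Matrix ι ι ℂ →ₗ[ℂ] Matrix ι' ι' ℂ) (Z : Matrix ι ι ℂ),
      B Z = ∑ i, ∑ j, Z i j • B (Matrix.single i j 1) := by
    intro B Z
    conv_lhs => rw [matrix_eq_sum_single Z]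
    simp only [map_sum, ← map_smul, smul_single, smul_eq_mul, mul_one]
  rw [hexp A₀]
  simp only [hexp (A _) (Y _)]
  refine tendsto_finsetSum _ fun i _ => tendsto_finsetSum _ fun j _ => Filter.Tendsto.smul ?_ (hA _)
  exact (((continuous_apply j).comp (continuous_apply i)).tendsto Y₀).comp hY

lemma tendsto_chainFrom {a b m : ℕ} (Λ : Op a →ₗ[ℂ] Op a)
    {G : ℕ → List (Fin m) → Fin m → BiOp a b →ₗ[ℂ] BiOp a b}
    {F : List (Fin m) → Fin m → BiOp a b →ₗ[ℂ] BiOp a b}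
    (hG : ∀ h j X, Filter.Tendsto (fun t => G t h j X) Filter.atTop (nhds (F h j X)))
    (n : ℕ) (h : List (Fin m)) (X : BiOp a b) :
    Filter.Tendsto (fun t => chainFrom Λ (G t) n h X) Filter.atTop
      (nhds (chainFrom Λ F n h X)) := by
  induction n generalizing h X with
  | zero => exact tendsto_const_nhds
  | succ n ih =>
    simp only [chainFrom, LinearMap.sum_apply, LinearMap.comp_apply]
    refine tendsto_finsetSum _ fun j _ => tendsto_linearMap_apply (ih (h ++ [j])) ?_
    exact tendsto_linearMap_apply (fun _ => tendsto_const_nhds) (hG h j X)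

/-- With D = d - 1 and y = (D/2) c^n the hypotheses say T ≤ 2 min(1, y), hence T ≤ 2 y^θ for every θ
in [0, 1]; θ = 1/(2D) produces the required exponent. -/
lemma le_of_le_pow_of_le_two {d : ℕ} (hd : 2 ≤ d) {c T : ℝ} (hc0 : 0 < c) (hc1 : c < 1) (n : ℕ)
    (h1 : T ≤ c ^ n * ((d : ℝ) - 1)) (h2 : T ≤ 2) :
    T ≤ 4 * c ^ ((n : ℝ) / (2 * ((d : ℝ) - 1))) * (√(d : ℝ) - 1) := by
  have hd' : (2 : ℝ) ≤ d := by exact_mod_cast hd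
  set D : ℝ := (d : ℝ) - 1
  have hD : 1 ≤ D := by simp only [D]; linarith
  have hD0 : 0 < D := by linarith
  set θ : ℝ := 1 / (2 * D) with hθ
  have hθ0 : 0 < θ := by positivity
  have hθ1 : θ ≤ 1 := by
    rw [hθ, div_le_one (by positivity)]
    linarith
  have hx0 : 0 < c ^ n := pow_pos hc0 n
  have hexp : c ^ ((n : ℝ) / (2 * D)) = (c ^ n) ^ θ := by
    rw [← Real.rpow_natCast, ← Real.rpow_mul hc0.le, hθ]
    congr 1
    ring
  rw [hexp]
  have hxθ : 0 ≤ (c ^ n) ^ θ := Real.rpow_nonneg hx0.le _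
  have hy0 : 0 < D / 2 * c ^ n := by positivity
  have hT : T ≤ 2 * (D / 2 * c ^ n) ^ θ := by
    rcases le_total (D / 2 * c ^ n) 1 with hy | hy
    · have := Real.rpow_le_rpow_of_exponent_ge hy0 hy hθ1
      rw [Real.rpow_one] at this
      linarith
    · have := Real.one_le_rpow hy hθ0.le
      linarith
  rw [Real.mul_rpow (by positivity) hx0.le] at hT
  -- Bernoulli bounds the prefactor by 5/4 - θ. The constant is tight for d = 2, where θ = 1/2 gives
  -- 3/2 against 4(√2 - 1) > 1.6; for d ≥ 3 the term -θ can be dropped.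
  have hbern : (D / 2) ^ θ ≤ 1 + θ * (D / 2 - 1) := by
    have := rpow_one_add_le_one_add_mul_self (s := D / 2 - 1) (by linarith) hθ0.le hθ1
    rwa [add_sub_cancel] at this
  have hθD : θ * (D / 2 - 1) = 1 / 4 - θ := by
    rw [hθ]
    field_simp
    ring
  rw [hθD] at hbern
  have hsqrt : 2 * (1 + (1 / 4 - θ)) ≤ 4 * (√(d : ℝ) - 1) := by
    rcases hd.eq_or_lt with rfl | hd3
    · have : D = 1 := by simp only [D]; norm_num
      have h14 : (1.4 : ℝ) ≤ √2 := Real.le_sqrt_of_sq_le (by norm_num)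
      rw [hθ, this]
      push_cast
      linarith
    · have hd3' : (3 : ℝ) ≤ d := by exact_mod_cast hd3
      have h17 : (1.7 : ℝ) ≤ √(d : ℝ) := Real.le_sqrt_of_sq_le (by linarith)
      linarith
  calc T ≤ 2 * ((D / 2) ^ θ * (c ^ n) ^ θ) := hT
    _ ≤ 2 * ((1 + (1 / 4 - θ)) * (c ^ n) ^ θ) := by gcongr
    _ = 2 * (1 + (1 / 4 - θ)) * (c ^ n) ^ θ := by ring
    _ ≤ 4 * (√(d : ℝ) - 1) * (c ^ n) ^ θ := mul_le_mul_of_nonneg_right hsqrt hxθ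
    _ = _ := by ring

/-- The minimal distance of a limit of states to the separable states is at most the limit of
bounds on the distances. -/
lemma exists_min_of_tendsto {a b : ℕ} {X : ℕ → BiOp a b} {X₀ : BiOp a b} {r : ℝ}
    (hX : ∀ t, IsState (X t)) (hlim : Filter.Tendsto X Filter.atTop (nhds X₀))
    (h : ∀ t, ∃ σ ∈ separableStates a b, traceNorm (X t - σ) ≤ r) :
    ∃ σ ∈ separableStates a b,
      (∀ τ ∈ separableStates a b, traceNorm (X₀ - σ) ≤ traceNorm (X₀ - τ)) ∧
        traceNorm (X₀ - σ) ≤ r := by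
  have hX₀ : X₀.PosSemidef :=
    isClosed_setOf_posSemidef.mem_of_tendsto hlim (Filter.Eventually.of_forall fun t => (hX t).1)
  choose σ hσ hr using h
  have hherm : ∀ τ ∈ separableStates a b, τ.IsHermitian := fun τ hτ =>
    (isState_of_mem_separableStates hτ).1.1
  obtain ⟨σ₀, hσ₀, hmin⟩ :=
    exists_min_traceNorm_sub (isCompact_separableStates a b) ⟨σ 0, hσ 0⟩ hherm hX₀.1
  refine ⟨σ₀, hσ₀, hmin, ?_⟩
  have hdiff : Filter.Tendsto (fun t => X₀ - X t) Filter.atTop (nhds 0) := by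
    have := (tendsto_const_nhds (x := X₀)).sub hlim
    rwa [sub_self] at this
  have h0 := (tendsto_traceNorm_zero (fun t => hX₀.1.sub (hX t).1.1) hdiff).add_const r
  rw [zero_add] at h0
  refine ge_of_tendsto' h0 fun t => ?_
  have h1 := traceNorm_add_le (hX₀.1.sub (hX t).1.1) ((hX t).1.1.sub (hherm _ (hσ t)))
  rw [sub_add_sub_cancel] at h1
  exact (hmin _ (hσ t)).trans (h1.trans (add_le_add le_rfl (hr t)))

end

end QNet

theorem theorem3 (dA : ℕ) (hdA : 2 ≤ dA) (Λ : QNet.Op dA →ₗ[ℂ] QNet.Op dA)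
    (hΛ : QNet.IsChannel Λ)
    (hno : ¬ ∃ H : Submodule ℂ (Fin dA → ℂ), QNet.IsCorrectable Λ H) :
    ∃ κ : ℝ, 0 < κ ∧ κ < 1 ∧
      ∀ (dB m : ℕ) (F : List (Fin m) → Fin m → QNet.BiOp dA dB →ₗ[ℂ] QNet.BiOp dA dB),
        (∀ h, QNet.IsLOCC (F h)) →
        ∀ (ρ : QNet.BiOp dA dB), QNet.IsState ρ → ∀ n : ℕ,
          ∃ σ ∈ QNet.separableStates dA dB,
            (∀ τ ∈ QNet.separableStates dA dB,
              QNet.traceNorm (QNet.chain Λ F n ρ - σ) ≤ QNet.traceNorm (QNet.chain Λ F n ρ - τ)) ∧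
            QNet.traceNorm (QNet.chain Λ F n ρ - σ) ≤
              4 * κ ^ ((n : ℝ) / (2 * ((dA : ℝ) - 1))) * (√(dA : ℝ) - 1) := by
  obtain ⟨κ, _, L, c, hL, hc0, hc1, hW⟩ := QNet.exists_wedgeContracts hΛ hno
  -- `c` comes from a Kraus family of `Λ` alone, so it is fixed before `dB`, the filters, the state
  -- and `n`.
  refine ⟨c, hc0, hc1, fun dB m F hF ρ hρ n => ?_⟩
  choose G hG hlim using hF
  have hent : ∀ t, QNet.EntLE (QNet.chain Λ (fun h => G h t) n ρ) (c ^ n * ((dA : ℝ) - 1)) :=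
    fun t => QNet.entLE_chainFrom hL hc0.le hW (fun h => hG h t) n [] hρ.entLE
  have htr : ∀ t, (QNet.chain Λ (fun h => G h t) n ρ).trace = 1 := fun t =>
    (QNet.trace_chainFrom hΛ (fun h => hG h t) n [] ρ).trans hρ.2
  refine QNet.exists_min_of_tendsto (fun t => ⟨(hent t).posSemidef, htr t⟩)
    (QNet.tendsto_chainFrom Λ (G := fun t h => G h t) hlim n [] ρ) fun t => ?_
  obtain ⟨σ, hσ, h1, h2⟩ := (hent t).exists_separable (htr t)
  exact ⟨σ, hσ, QNet.le_of_le_pow_of_le_two hdA hc0 hc1 n h1 h2⟩
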